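/- Let $S$ be a regular local ring with maximal ideal $\mathfrak m_S$, let $I\subseteq\mathfrak m_S^2$ be an ideal, and let $A=S/I$. Assume that $A$ is a local Artinian Gorenstein ring with maximal ideal $\mathfrak M$, whose residue field $k=A/\mathfrak M$ is algebraically closed of characteristic different from $2$ and $3$. ($A$ need not be a $k$-algebra.) Assume that the Hilbert function $H_A(t)=\dim_k(\mathfrak M^t/\mathfrak M^{t+1})$ is $(1,n,3,1)$, i.e. $H_A(0)=1$, $H_A(1)=n$, $H_A(2)=3$, $H_A(3)=1$, and $H_A(t)=0$ for $t\ge4$. Then $n\ge3$, and there is a minimal set of generators $\{x_1,\dots,x_n\}$ of $\mathfrak m_S$ such that $I$ is one of the following six ideals, where in each case $x_ix_j$ ranges over $1\le i<j\le n$ with $j\ge4$ (except in $I_4$, where it ranges over all $1\le i<j\le n$), and $h$ ranges over $4\le h\le n$: $$ \begin{aligned} I_1&=(x_1x_2+x_3^2,\ x_1x_3,\ x_1^2+x_2^2-\alpha x_3^2,\ x_ix_j,\ x_h^2-x_1^3)\quad\text{for some }\alpha\in S,\\ I_2&=(x_1^2,\ x_2^2,\ x_3^2+2x_1x_2,\ x_ix_j,\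 x_h^2-x_1x_2x_3),\\ I_3&=(x_1^2,\ x_2^2,\ x_3^2,\ x_ix_j,\ x_h^2-x_1x_2x_3),\\ I_4&=(x_2^3-x_1^3,\ x_3^3-x_1^3,\ x_ix_j,\ x_h^2-x_1^3),\\ I_5&=(x_1^2,\ x_1x_2,\ x_2x_3,\ x_2^3-x_3^3,\ x_1x_3^2-x_3^3,\ x_ix_j,\ x_h^2-x_3^3),\\ I_6&=(x_1^2,\ x_1x_2,\ 2x_1x_3+x_2^2,\ x_3^3,\ x_2x_3^2,\ x_ix_j,\ x_h^2-x_1x_3^2). \end{aligned} $$ -/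

import Mathlib

universe u

/-- The Hilbert function `t ↦ dim_k (M ^ t / M ^ (t + 1))` of a local ring `A` with maximal ideal
`M` and residue field `k = A / M`. Here `M ^ (t + 1)` is written as `M • M ^ t`, so that the
quotient is literally a vector space over `A ⧸ M`. -/
noncomputable def localHilbertFunction (A : Type u) [CommRing A] [IsLocalRing A] (t : ℕ) : ℕ :=
  Module.finrank (A ⧸ IsLocalRing.maximalIdeal A)
    (↥(IsLocalRing.maximalIdeal A ^ t) ⧸
      (IsLocalRing.maximalIdeal A • ⊤ : Submodule A ↥(IsLocalRing.maximalIdeal A ^ t)))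

/-- A local ring is Gorenstein if it is Noetherian and has finite injective dimension as a module
over itself. (Such a ring is automatically Cohen-Macaulay.) -/
structure IsGorensteinLocalRing (A : Type u) [CommRing A] : Prop where
  isLocalRing : IsLocalRing A
  isNoetherianRing : IsNoetherianRing A
  finite_injectiveDimension :
    ∃ d : ℕ, CategoryTheory.HasInjectiveDimensionLE (ModuleCat.of A A) d

/-- `x 1, …, x n` is a minimal set of generators of the ideal `J`: these elements generate `J`, and
no proper subfamily does. The values of `x` outside `{1, …, n}` play no role. -/
def IsMinimalGenerators {S : Type u} [CommRing S] (n : ℕ) (x : ℕ → S) (J : Ideal S) : Prop :=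
  Ideal.span (x '' Set.Icc 1 n) = J ∧ ∀ T : Set ℕ, T ⊂ Set.Icc 1 n → Ideal.span (x '' T) ≠ J

namespace GorensteinNormalForm

variable {S : Type u} [CommRing S] (n : ℕ) (x : ℕ → S)

/-- The elements `x_i x_j` with `1 ≤ i < j ≤ n` and `4 ≤ j`. -/
def mixedProducts : Set S :=
  {z | ∃ i j : ℕ, 1 ≤ i ∧ i < j ∧ j ≤ n ∧ 4 ≤ j ∧ z = x i * x j}

/-- The elements `x_i x_j` with `1 ≤ i < j ≤ n`. -/
def allMixedProducts : Set S :=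
  {z | ∃ i j : ℕ, 1 ≤ i ∧ i < j ∧ j ≤ n ∧ z = x i * x j}

/-- The elements `x_h ^ 2 - s` with `4 ≤ h ≤ n`. -/
def squaresMinus (s : S) : Set S :=
  {z | ∃ h : ℕ, 4 ≤ h ∧ h ≤ n ∧ z = x h ^ 2 - s}

/-- The ideal `I₁`, depending on the parameter `α`. -/
def I₁ (α : S) : Ideal S :=
  Ideal.span ({x 1 * x 2 + x 3 ^ 2, x 1 * x 3, x 1 ^ 2 + x 2 ^ 2 - α * x 3 ^ 2}
    ∪ mixedProducts n x ∪ squaresMinus n x (x 1 ^ 3))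

/-- The ideal `I₂`. -/
def I₂ : Ideal S :=
  Ideal.span ({x 1 ^ 2, x 2 ^ 2, x 3 ^ 2 + 2 * x 1 * x 2}
    ∪ mixedProducts n x ∪ squaresMinus n x (x 1 * x 2 * x 3))

/-- The ideal `I₃`. -/
def I₃ : Ideal S :=
  Ideal.span ({x 1 ^ 2, x 2 ^ 2, x 3 ^ 2}
    ∪ mixedProducts n x ∪ squaresMinus n x (x 1 * x 2 * x 3))

/-- The ideal `I₄`. -/
def I₄ : Ideal S :=
  Ideal.span ({x 2 ^ 3 - x 1 ^ 3, x 3 ^ 3 - x 1 ^ 3}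
    ∪ allMixedProducts n x ∪ squaresMinus n x (x 1 ^ 3))

/-- The ideal `I₅`. -/
def I₅ : Ideal S :=
  Ideal.span ({x 1 ^ 2, x 1 * x 2, x 2 * x 3, x 2 ^ 3 - x 3 ^ 3, x 1 * x 3 ^ 2 - x 3 ^ 3}
    ∪ mixedProducts n x ∪ squaresMinus n x (x 3 ^ 3))

/-- The ideal `I₆`. -/
def I₆ : Ideal S :=
  Ideal.span ({x 1 ^ 2, x 1 * x 2, 2 * x 1 * x 3 + x 2 ^ 2, x 3 ^ 3, x 2 * x 3 ^ 2}
    ∪ mixedProducts n x ∪ squaresMinus n x (x 1 * x 3 ^ 2))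

end GorensteinNormalForm

/-! ### Common zeros of few polynomials, via Krull's height theorem. -/

section CommonZero

open MvPolynomial

/-! An Artinian Gorenstein local ring is injective over itself, so its socle is generated by any of
its nonzero elements. Here the socle is `M ^ 3 = A s`. Since `M * s = 0`, a multiple `c * s` depends
only on the residue of `c`. Products that land in the socle therefore have well-defined values in
`k`, although `A` need not contain `k`.

Multiplication `M × M ^ 2 → M ^ 3 ≅ k` induces a perfect pairing of `M / (0 : M ^ 2)` with `M ^ 2 /
M ^ 3`, so the former space has dimension 3 and the triple product is a ternary cubic on it that is
not a cone. Such cubics fall into six families (`hasCubicNormalForm`): two polynomials without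
constant term in three variables have a nontrivial common zero, so some point lies on both the cubic
and its Hessian. It is a flex or a singular point, and coordinates adapted to it put the cubic into
normal form.

In these coordinates the quadratic relations of the normal form hold up to multiples of `s`. Adding
elements of `M ^ 2` to the coordinates absorbs these errors, because 2 is invertible, and leaves the
triple products unchanged, so the cubic relations hold as well (`exists_satisfiesNormalForm`). On
the part of `(0 : M ^ 2)` orthogonal to the three coordinates, multiplication is a symmetric
bilinear form with values in `A s`. A maximal orthonormal family for it supplies the remaining `n -
3` generators (`exists_isOrthonormalFamily`).

After lifting to `S`, the ideal `J` of the normal form is contained in `I`. Conversely, the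
relations alone show that modulo `J` the square of the maximal ideal is spanned by three quadrics,
their products with the maximal ideal are multiples of one element `σ`, and `σ` is killed by the
maximal ideal. As `H(2) = 3` and `σ ∉ I`, nothing more can vanish modulo `I`
(`le_of_isQuadricBasis`). -/

/-- The height of the ideal of the origin in affine `n`-space is at least `n`. -/
theorem le_height_vanishingIdeal_zero (k : Type*) [Field k] (n : ℕ) :
    (n : ℕ∞) ≤ (vanishingIdeal k {(0 : Fin n → k)}).height := by
  -- `φ i` substitutes 0 for the first `i` variables. The target is a domain, so the kernels for `i
  -- = 0, …, n` form a strictly increasing chain of primes, the last of which lies in the ideal of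
  -- the origin.
  let φ : ℕ → MvPolynomial (Fin n) k →ₐ[k] MvPolynomial (Fin n) k :=
    fun i ↦ aeval fun j ↦ if (j : ℕ) < i then 0 else X j
  have hX (i : ℕ) (j : Fin n) : φ i (X j) = if (j : ℕ) < i then 0 else X j := by simp [φ]
  have hprime (i : ℕ) : (RingHom.ker (φ i)).IsPrime := RingHom.ker_isPrime _
  have hlt (i : ℕ) (hi : i < n) : RingHom.ker (φ i) < RingHom.ker (φ (i + 1)) := by
    have hcomp : φ (i + 1) = (φ (i + 1)).comp (φ i) := by
      ext1 j
      rw [AlgHom.comp_apply, hX i]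
      split_ifs with h
      · rw [map_zero, hX, if_pos (by omega)]
      · rfl
    refine lt_of_le_of_ne (fun p hp ↦ ?_) fun h ↦ ?_
    · rw [RingHom.mem_ker] at hp ⊢
      rw [hcomp, AlgHom.comp_apply, hp, map_zero]
    · have h1 : X ⟨i, hi⟩ ∈ RingHom.ker (φ (i + 1)) := by
        rw [RingHom.mem_ker, hX, if_pos (Nat.lt_succ_self i)]
      rw [← h, RingHom.mem_ker, hX, if_neg (lt_irrefl i)] at h1
      exact X_ne_zero _ h1
  have hheight : ∀ i ≤ n, (i : ℕ∞) ≤ (RingHom.ker (φ i)).height := by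
    intro i
    induction i with
    | zero => simp
    | succ i ih =>
      intro hi
      have := Ideal.height_add_one_le_of_lt_of_isPrime (hlt i (by omega))
      push_cast
      exact (add_le_add_left (ih (by omega)) 1).trans this
  refine (hheight n le_rfl).trans (Ideal.height_mono fun p hp ↦ ?_)
  rw [mem_vanishingIdeal_singleton_iff]
  have h0 : (fun j : Fin n ↦ if (j : ℕ) < n then (0 : MvPolynomial (Fin n) k) else X j)
      = fun _ ↦ 0 := funext fun j ↦ if_pos j.2
  have h1 : φ n p = C (constantCoeff p) := by
    simp only [φ, h0, aeval_zero', algebraMap_eq]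
  rw [RingHom.mem_ker, h1] at hp
  rw [aeval_zero]
  exact C_eq_zero.mp hp

/-- Fewer polynomials without constant term than variables have a nontrivial common zero over an
algebraically closed field. -/
theorem exists_ne_zero_common_zero {k : Type*} [Field k] [IsAlgClosed k] {n : ℕ}
    (s : Finset (MvPolynomial (Fin n) k)) (hs : s.card < n)
    (h0 : ∀ p ∈ s, constantCoeff p = 0) :
    ∃ a : Fin n → k, a ≠ 0 ∧ ∀ p ∈ s, eval a p = 0 := by
  -- If the origin is the only common zero, the Nullstellensatz makes its ideal the radical of the
  -- span, hence a minimal prime over `s.card` elements. Krull's theorem then bounds its height by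
  -- `s.card < n`.
  by_contra! hcon
  set m : Ideal (MvPolynomial (Fin n) k) := vanishingIdeal k {(0 : Fin n → k)} with hm
  have hmax : m.IsMaximal := inferInstance
  have hrad : (Ideal.span (s : Set (MvPolynomial (Fin n) k))).radical = m := by
    rw [← vanishingIdeal_zeroLocus_eq_radical (K := k), zeroLocus_span, hm]
    congr 1
    ext x
    simp only [Set.mem_ofPred_eq, Finset.mem_coe, Set.mem_singleton_iff]
    constructor
    · intro hx
      by_contra hne
      obtain ⟨p, hp, hpx⟩ := hcon x hne
      exact hpx (by simpa [aeval_def] using hx p hp)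
    · rintro rfl p hp
      simpa [aeval_def] using h0 p hp
  have hmin : m ∈ (Ideal.span (s : Set (MvPolynomial (Fin n) k))).minimalPrimes := by
    rw [← Ideal.radical_minimalPrimes, hrad, Ideal.minimalPrimes_eq_subsingleton_self]
    rfl
  have h1 : m.height ≤ s.card := Ideal.height_le_card_of_mem_minimalPrimes_span_finset hmin
  have h2 : (n : ℕ∞) ≤ m.height := le_height_vanishingIdeal_zero k n
  have := h2.trans h1
  exact absurd (by exact_mod_cast this) (not_le.mpr hs)

end CommonZero

/-! ### Ternary cubics as symmetric trilinear forms: reduction to normal form from a flex or a line.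
-/

section TernaryCubics

/-- The list of the values of a symmetric trilinear form on a triple of vectors. -/
def CubicValues {R V : Type*} (T : V → V → V → R) (e₁ e₂ e₃ : V)
    (t₁₁₁ t₁₁₂ t₁₁₃ t₁₂₂ t₁₂₃ t₁₃₃ t₂₂₂ t₂₂₃ t₂₃₃ t₃₃₃ : R) : Prop :=
  T e₁ e₁ e₁ = t₁₁₁ ∧ T e₁ e₁ e₂ = t₁₁₂ ∧ T e₁ e₁ e₃ = t₁₁₃ ∧ T e₁ e₂ e₂ = t₁₂₂ ∧
    T e₁ e₂ e₃ = t₁₂₃ ∧ T e₁ e₃ e₃ = t₁₃₃ ∧ T e₂ e₂ e₂ = t₂₂₂ ∧ T e₂ e₂ e₃ = t₂₂₃ ∧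
    T e₂ e₃ e₃ = t₂₃₃ ∧ T e₃ e₃ e₃ = t₃₃₃

/-- The six normal forms of nondegenerate ternary cubics, written as symmetric trilinear forms, up
to the scalar `c`. -/
def IsCubicNormalForm {R V : Type*} [CommRing R] (T : V → V → V → R)
    (e₁ e₂ e₃ : V) (c : R) : Prop :=
  (∃ α : R, CubicValues T e₁ e₂ e₃ c 0 0 (-c) 0 0 (α * c) 0 c 0) ∨
    CubicValues T e₁ e₂ e₃ 0 0 0 0 c 0 0 0 0 (-(2 * c)) ∨
    CubicValues T e₁ e₂ e₃ 0 0 0 0 c 0 0 0 0 0 ∨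
    CubicValues T e₁ e₂ e₃ c 0 0 0 0 0 c 0 0 c ∨
    CubicValues T e₁ e₂ e₃ 0 0 0 0 0 c c 0 0 c ∨
    CubicValues T e₁ e₂ e₃ 0 0 0 0 0 c 0 (-(2 * c)) 0 0

variable {k V : Type*} [Field k] [AddCommGroup V] [Module k V]

/-- `T` is a symmetric trilinear form. -/
structure IsSymmTrilinear (T : V → V → V → k) : Prop where
  add_left : ∀ x x' y z, T (x + x') y z = T x y z + T x' y z
  smul_left : ∀ (a : k) x y z, T (a • x) y z = a * T x y z
  swap_left : ∀ x y z, T x y z = T y x z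
  swap_right : ∀ x y z, T x y z = T x z y

/-- `T` takes the values of one of the normal forms on some triple of vectors. -/
def HasCubicNormalForm (T : V → V → V → k) : Prop :=
  ∃ (e₁ e₂ e₃ : V) (c : k), c ≠ 0 ∧ IsCubicNormalForm T e₁ e₂ e₃ c

/-- Used for a point where a line meets a conic, and for a tangent direction at a singular point of
a cubic. -/
theorem exists_isotropic [IsAlgClosed k] (a b c : k) :
    ∃ x y : k, (x ≠ 0 ∨ y ≠ 0) ∧ a * x ^ 2 + b * x * y + c * y ^ 2 = 0 := by
  by_cases ha : a = 0
  · exact ⟨1, 0, Or.inl one_ne_zero, by simp [ha]⟩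
  · obtain ⟨x, hx⟩ := IsAlgClosed.exists_root
      (Polynomial.C a * Polynomial.X ^ 2 + Polynomial.C b * Polynomial.X + Polynomial.C c)
      (by rw [Polynomial.degree_quadratic ha]; decide)
    refine ⟨x, 1, Or.inr one_ne_zero, ?_⟩
    simpa [Polynomial.IsRoot] using hx

namespace IsSymmTrilinear

variable {T : V → V → V → k} (h : IsSymmTrilinear T)
include h

theorem zero_left (y z : V) : T 0 y z = 0 := by
  simpa using h.smul_left 0 0 y z

theorem comb_left (e₁ e₂ e₃ : V) (a₁ a₂ a₃ : k) (y z : V) :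
    T (a₁ • e₁ + a₂ • e₂ + a₃ • e₃) y z = a₁ * T e₁ y z + a₂ * T e₂ y z + a₃ * T e₃ y z := by
  simp only [h.add_left, h.smul_left]

theorem comb_mid (e₁ e₂ e₃ : V) (a₁ a₂ a₃ : k) (x z : V) :
    T x (a₁ • e₁ + a₂ • e₂ + a₃ • e₃) z = a₁ * T x e₁ z + a₂ * T x e₂ z + a₃ * T x e₃ z := by
  simp only [h.swap_left x, h.comb_left]

theorem comb_right (e₁ e₂ e₃ : V) (a₁ a₂ a₃ : k) (x y : V) :
    T x y (a₁ • e₁ + a₂ • e₂ + a₃ • e₃) = a₁ * T x y e₁ + a₂ * T x y e₂ + a₃ * T x y e₃ := by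
  simp only [h.swap_right x y, h.comb_mid]

/-- Every change of coordinates below is verified by rewriting with this expansion, which is why the
new vectors are written with explicit coefficients 0 and 1. -/
theorem comb (e₁ e₂ e₃ : V) (a₁ a₂ a₃ b₁ b₂ b₃ c₁ c₂ c₃ : k) :
    T (a₁ • e₁ + a₂ • e₂ + a₃ • e₃) (b₁ • e₁ + b₂ • e₂ + b₃ • e₃)
        (c₁ • e₁ + c₂ • e₂ + c₃ • e₃) =
      a₁ * b₁ * c₁ * T e₁ e₁ e₁ + (a₁ * b₁ * c₂ + a₁ * b₂ * c₁ + a₂ * b₁ * c₁) * T e₁ e₁ e₂ +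
      (a₁ * b₁ * c₃ + a₁ * b₃ * c₁ + a₃ * b₁ * c₁) * T e₁ e₁ e₃ +
      (a₁ * b₂ * c₂ + a₂ * b₁ * c₂ + a₂ * b₂ * c₁) * T e₁ e₂ e₂ +
      (a₁ * b₂ * c₃ + a₁ * b₃ * c₂ + a₂ * b₁ * c₃ + a₂ * b₃ * c₁ + a₃ * b₁ * c₂ + a₃ * b₂ * c₁) *
        T e₁ e₂ e₃ +
      (a₁ * b₃ * c₃ + a₃ * b₁ * c₃ + a₃ * b₃ * c₁) * T e₁ e₃ e₃ +
      a₂ * b₂ * c₂ * T e₂ e₂ e₂ + (a₂ * b₂ * c₃ + a₂ * b₃ * c₂ + a₃ * b₂ * c₂) * T e₂ e₂ e₃ +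
      (a₂ * b₃ * c₃ + a₃ * b₂ * c₃ + a₃ * b₃ * c₂) * T e₂ e₃ e₃ + a₃ * b₃ * c₃ * T e₃ e₃ e₃ := by
  simp only [h.comb_left, h.comb_mid, h.comb_right]
  rw [h.swap_right e₁ e₂ e₁, h.swap_left e₂ e₁ e₁, h.swap_right e₁ e₃ e₁, h.swap_left e₃ e₁ e₁,
    h.swap_left e₂ e₁ e₂, h.swap_right e₂ e₂ e₁, h.swap_left e₂ e₁ e₂, h.swap_right e₁ e₃ e₂,
    h.swap_left e₂ e₁ e₃, h.swap_right e₂ e₃ e₁, h.swap_left e₂ e₁ e₃,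
    h.swap_left e₃ e₁ e₂, h.swap_right e₁ e₃ e₂, h.swap_left e₃ e₂ e₁, h.swap_right e₂ e₃ e₁,
    h.swap_left e₂ e₁ e₃, h.swap_left e₃ e₁ e₃, h.swap_right e₃ e₃ e₁, h.swap_left e₃ e₁ e₃,
    h.swap_right e₂ e₃ e₂, h.swap_left e₃ e₂ e₂, h.swap_left e₃ e₂ e₃, h.swap_right e₃ e₃ e₂,
    h.swap_left e₃ e₂ e₃, h.swap_right e₁ e₂ e₁, h.swap_right e₁ e₃ e₁, h.swap_right e₂ e₃ e₂]
  ring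

/-- The cuspidal cubic `p x ^ 3 + 3 t y z ^ 2`. -/
theorem normalForm_of_cusp (h3 : (3 : k) ≠ 0) {e₁ e₂ e₃ : V} {p t : k} (hp : p ≠ 0) (ht : t ≠ 0)
    (hv : CubicValues T e₁ e₂ e₃ p 0 0 0 0 0 0 0 t 0) : HasCubicNormalForm T := by
  obtain ⟨h111, h112, h113, h122, h123, h133, h222, h223, h233, h333⟩ := hv
  -- The old first vector becomes the second one. The summand `(p / (3 * t)) • e₂` of the third
  -- vector creates the cube of the third coordinate that the normal form contains.
  refine ⟨(0 : k) • e₁ + (p / t) • e₂ + (0 : k) • e₃, (1 : k) • e₁ + (0 : k) • e₂ + (0 : k) • e₃,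
    (0 : k) • e₁ + (p / (3 * t)) • e₂ + (1 : k) • e₃, p, hp, ?_⟩
  refine Or.inr <| Or.inr <| Or.inr <| Or.inr <| Or.inl ?_
  refine ⟨?_, ?_, ?_, ?_, ?_, ?_, ?_, ?_, ?_, ?_⟩ <;>
    rw [h.comb, h111, h112, h113, h122, h123, h133, h222, h223, h233, h333] <;> field_simp <;> ring

/-- The Weierstrass cubic `p x ^ 3 + 3 q x y ^ 2 + r y ^ 3 + 3 t y z ^ 2`. -/
theorem normalForm_of_weierstrass [IsAlgClosed k] (h2 : (2 : k) ≠ 0) (h3 : (3 : k) ≠ 0)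
    {e₁ e₂ e₃ : V} {p q r t : k} (hp : p ≠ 0) (ht : t ≠ 0)
    (hv : CubicValues T e₁ e₂ e₃ p 0 0 q 0 0 r 0 t 0) : HasCubicNormalForm T := by
  have hv' := hv
  obtain ⟨h111, h112, h113, h122, h123, h133, h222, h223, h233, h333⟩ := hv
  by_cases hq : q = 0
  · by_cases hr : r = 0
    · subst hq hr
      exact h.normalForm_of_cusp h3 hp ht hv'
    -- With `y = Y + Z` and `z = γ (Y - Z)`, where `γ ^ 2 * t = r`, the binary part `r y ^ 3 + 3 t y
    -- z ^ 2` becomes `4 r (Y ^ 3 + Z ^ 3)`, and `δ` rescales `x`: this is the Fermat cubic.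
    · obtain ⟨γ, hγ⟩ := IsAlgClosed.exists_pow_nat_eq (r / t) two_pos
      obtain ⟨δ, hδ⟩ := IsAlgClosed.exists_pow_nat_eq (4 * r / p) three_pos
      have hγ' : γ ^ 2 * t = r := by rw [hγ]; field_simp
      have hδ' : δ ^ 3 * p = 4 * r := by rw [hδ]; field_simp
      have h4 : (4 : k) ≠ 0 := by
        have : (4 : k) = 2 * 2 := by norm_num
        rw [this]; exact mul_ne_zero h2 h2
      refine ⟨δ • e₁ + (0 : k) • e₂ + (0 : k) • e₃, (0 : k) • e₁ + (1 : k) • e₂ + γ • e₃,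
        (0 : k) • e₁ + (1 : k) • e₂ + (-γ) • e₃, 4 * r, mul_ne_zero h4 hr, ?_⟩
      refine Or.inr <| Or.inr <| Or.inr <| Or.inl ?_
      refine ⟨?_, ?_, ?_, ?_, ?_, ?_, ?_, ?_, ?_, ?_⟩ <;>
        rw [h.comb, h111, h112, h113, h122, h123, h133, h222, h223, h233, h333] <;> try rw [hq]
      · linear_combination hδ'
      · ring
      · ring
      · ring
      · ring
      · ring
      · linear_combination 3 * hγ'
      · linear_combination -hγ'
      · linear_combination -hγ'
      · linear_combination 3 * hγ'
  -- Rescaling `y` by `μ` and `z` by `ν` turns `q` into `-p` and `t` into `p`. The coefficient of `y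
  -- ^ 3` is then the free parameter.
  · obtain ⟨μ, hμ⟩ := IsAlgClosed.exists_pow_nat_eq (-p / q) two_pos
    have hμ0 : μ ≠ 0 := by
      rintro rfl
      exact div_ne_zero (neg_ne_zero.mpr hp) hq (by simpa using hμ.symm)
    obtain ⟨ν, hν⟩ := IsAlgClosed.exists_pow_nat_eq (p / (μ * t)) two_pos
    have hμ' : μ ^ 2 * q = -p := by rw [hμ]; field_simp
    have hν' : μ * ν ^ 2 * t = p := by rw [hν]; field_simp
    refine ⟨(1 : k) • e₁ + (0 : k) • e₂ + (0 : k) • e₃, (0 : k) • e₁ + μ • e₂ + (0 : k) • e₃,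
      (0 : k) • e₁ + (0 : k) • e₂ + ν • e₃, p, hp, Or.inl ⟨μ ^ 3 * r / p, ?_⟩⟩
    refine ⟨?_, ?_, ?_, ?_, ?_, ?_, ?_, ?_, ?_, ?_⟩ <;>
      rw [h.comb, h111, h112, h113, h122, h123, h133, h222, h223, h233, h333]
    · ring
    · ring
    · ring
    · linear_combination hμ'
    · ring
    · ring
    · field_simp; ring
    · ring
    · linear_combination hν'
    · ring

/-- A cubic with a nonsingular flex. -/
theorem normalForm_of_smooth_flex [IsAlgClosed k] (h2 : (2 : k) ≠ 0) (h3 : (3 : k) ≠ 0)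
    {e₁ e₂ e₃ : V} {p a q b r d t : k} (hp : p ≠ 0) (ht : t ≠ 0)
    (hv : CubicValues T e₁ e₂ e₃ p a 0 q b 0 r d t 0) : HasCubicNormalForm T := by
  obtain ⟨h111, h112, h113, h122, h123, h133, h222, h223, h233, h333⟩ := hv
  -- Completing the square in `z`: this shift removes `x y z`, and the shift by `-d / (2 * t)` below
  -- removes `y ^ 2 z`. The first shift changes the coefficient of `x ^ 2 y` to `a'`, which is
  -- removed by completing the cube in `x`.
  obtain ⟨e₁', he₁⟩ : ∃ x, x = (1 : k) • e₁ + (0 : k) • e₂ + (-b / t) • e₃ := ⟨_, rfl⟩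
  obtain ⟨a', ha⟩ : ∃ x, x = T e₁' e₁' e₂ := ⟨_, rfl⟩
  have e2 : e₂ = (0 : k) • e₁ + (1 : k) • e₂ + (0 : k) • e₃ := by simp
  have e3 : e₃ = (0 : k) • e₁ + (0 : k) • e₂ + (1 : k) • e₃ := by simp
  have k111 : T e₁' e₁' e₁' = p := by
    rw [he₁, h.comb, h111, h112, h113, h122, h123, h133, h222, h223, h233, h333]; ring
  have k113 : T e₁' e₁' e₃ = 0 := by
    rw [he₁]; nth_rw 3 [e3]
    rw [h.comb, h111, h112, h113, h122, h123, h133, h222, h223, h233, h333]; ring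
  have k123 : T e₁' e₂ e₃ = 0 := by
    rw [he₁]; nth_rw 2 [e2]; nth_rw 3 [e3]
    rw [h.comb, h111, h112, h113, h122, h123, h133, h222, h223, h233, h333]; field_simp; ring
  have k133 : T e₁' e₃ e₃ = 0 := by
    rw [he₁]; nth_rw 2 3 [e3]
    rw [h.comb, h111, h112, h113, h122, h123, h133, h222, h223, h233, h333]; ring
  refine h.normalForm_of_weierstrass h2 h3 (e₁ := (1 : k) • e₁' + (0 : k) • e₂ + (0 : k) • e₃)
    (e₂ := (-a' / p) • e₁' + (1 : k) • e₂ + (-d / (2 * t)) • e₃)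
    (e₃ := (0 : k) • e₁' + (0 : k) • e₂ + (1 : k) • e₃) hp ht
    ⟨?_, ?_, ?_, rfl, ?_, ?_, rfl, ?_, ?_, ?_⟩ <;>
    rw [h.comb, k111, ← ha, k113, k123, k133, h222, h223, h233, h333] <;>
    field_simp <;> ring

/-- A nodal cubic, or a conic and a secant line. -/
theorem normalForm_of_node [IsAlgClosed k] (h2 : (2 : k) ≠ 0) (h3 : (3 : k) ≠ 0)
    {e₁ e₂ e₃ : V} {p b r : k} (hp : p ≠ 0) (hb : b ≠ 0)
    (hv : CubicValues T e₁ e₂ e₃ p 0 0 0 b 0 r 0 0 0) : HasCubicNormalForm T := by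
  obtain ⟨h111, h112, h113, h122, h123, h133, h222, h223, h233, h333⟩ := hv
  by_cases hr : r = 0
  · refine ⟨(0 : k) • e₁ + (-p / (2 * b)) • e₂ + (0 : k) • e₃,
      (0 : k) • e₁ + (0 : k) • e₂ + (1 : k) • e₃, (1 : k) • e₁ + (0 : k) • e₂ + (0 : k) • e₃,
      -p / 2, div_ne_zero (neg_ne_zero.mpr hp) h2, Or.inr <| Or.inl ?_⟩
    refine ⟨?_, ?_, ?_, ?_, ?_, ?_, ?_, ?_, ?_, ?_⟩ <;>
      rw [h.comb, h111, h112, h113, h122, h123, h133, h222, h223, h233, h333] <;> try rw [hr]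
    all_goals field_simp
    all_goals ring
  · obtain ⟨ρ, hρ⟩ := IsAlgClosed.exists_pow_nat_eq (p / r) three_pos
    have hρ0 : ρ ≠ 0 := by
      rintro rfl
      exact div_ne_zero hp hr (by simpa using hρ.symm)
    have hρ' : ρ ^ 3 * r = p := by rw [hρ]; field_simp
    -- The nodal cubic `p x ^ 3 + 6 b x y z + r y ^ 3` has a smooth flex at `e₁ - ρ • e₂`. The new
    -- first vector lies on the flex tangent, and the new second vector is a multiple of the node
    -- `e₃`.
    refine h.normalForm_of_smooth_flex h2 h3
      (e₁ := (1 : k) • e₁ + (0 : k) • e₂ + (p / (2 * ρ * b)) • e₃)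
      (e₂ := (0 : k) • e₁ + (0 : k) • e₂ + (p / (ρ * b)) • e₃)
      (e₃ := (1 : k) • e₁ + (-ρ) • e₂ + (0 : k) • e₃) (t := -(2 * p)) hp
      (neg_ne_zero.mpr (mul_ne_zero h2 hp))
      ⟨?_, rfl, ?_, rfl, rfl, ?_, rfl, rfl, ?_, ?_⟩ <;>
      rw [h.comb, h111, h112, h113, h122, h123, h133, h222, h223, h233, h333]
    · ring
    · field_simp; ring
    · field_simp; ring
    · field_simp; ring
    · linear_combination -hρ'

/-- A cubic with a singular point, one of whose tangents meets the cubic only at this point. -/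
theorem normalForm_of_singular_flex [IsAlgClosed k] (h2 : (2 : k) ≠ 0) (h3 : (3 : k) ≠ 0)
    {e₁ e₂ e₃ : V} {p a q b r d : k} (hp : p ≠ 0) (hbd : b ≠ 0 ∨ d ≠ 0)
    (hv : CubicValues T e₁ e₂ e₃ p a 0 q b 0 r d 0 0) : HasCubicNormalForm T := by
  obtain ⟨h111, h112, h113, h122, h123, h133, h222, h223, h233, h333⟩ := hv
  have e1 : e₁ = (1 : k) • e₁ + (0 : k) • e₂ + (0 : k) • e₃ := by simp
  have e3 : e₃ = (0 : k) • e₁ + (0 : k) • e₂ + (1 : k) • e₃ := by simp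
  -- The tangent cone at the singular point `e₃` is `y (2 b x + d y) = 0`. If `b ≠ 0` there are two
  -- tangents and `ν` moves the second one to `x = 0`. If `b = 0` the tangent is double and `ν`
  -- completes the cube in `x` instead. Multiples of `e₃` remove the other unwanted terms
  -- afterwards.
  obtain ⟨ν, hν⟩ : ∃ ν : k, (b = 0 → a + ν * p = 0) ∧ (b ≠ 0 → d + 2 * ν * b = 0) := by
    by_cases hb : b = 0
    · exact ⟨-a / p, fun _ ↦ by field_simp; ring, fun h ↦ absurd hb h⟩
    · exact ⟨-d / (2 * b), fun h ↦ absurd h hb, fun _ ↦ by field_simp; ring⟩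
  obtain ⟨e₂', he₂⟩ : ∃ x, x = ν • e₁ + (1 : k) • e₂ + (0 : k) • e₃ := ⟨_, rfl⟩
  have k112 : T e₁ e₁ e₂' = a + ν * p := by
    rw [he₂]; nth_rw 1 2 [e1]
    rw [h.comb, h111, h112, h113, h122, h123, h133, h222, h223, h233, h333]; ring
  obtain ⟨q', k122⟩ : ∃ x, T e₁ e₂' e₂' = x := ⟨_, rfl⟩
  obtain ⟨r', k222⟩ : ∃ x, T e₂' e₂' e₂' = x := ⟨_, rfl⟩
  have k123 : T e₁ e₂' e₃ = b := by
    rw [he₂]; nth_rw 1 [e1]; nth_rw 3 [e3]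
    rw [h.comb, h111, h112, h113, h122, h123, h133, h222, h223, h233, h333]; ring
  have k223 : T e₂' e₂' e₃ = d + 2 * ν * b := by
    rw [he₂]; nth_rw 3 [e3]
    rw [h.comb, h111, h112, h113, h122, h123, h133, h222, h223, h233, h333]; ring
  have k233 : T e₂' e₃ e₃ = 0 := by
    rw [he₂]; nth_rw 2 3 [e3]
    rw [h.comb, h111, h112, h113, h122, h123, h133, h222, h223, h233, h333]; ring
  by_cases hb : b = 0
  · have hd : d ≠ 0 := hbd.resolve_left (not_not.mpr hb)
    refine h.normalForm_of_cusp h3 (e₁ := (1 : k) • e₁ + (0 : k) • e₂' + (-q' / d) • e₃)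
      (e₂ := (0 : k) • e₁ + (0 : k) • e₂' + (1 : k) • e₃)
      (e₃ := (0 : k) • e₁ + (1 : k) • e₂' + (-r' / (3 * d)) • e₃) hp hd
      ⟨?_, ?_, ?_, ?_, ?_, ?_, ?_, ?_, ?_, ?_⟩ <;>
      rw [h.comb, h111, k112, h113, k122, k123, h133, k222, k223, k233, h333, hν.1 hb, hb]
    all_goals field_simp
    all_goals ring
  · refine h.normalForm_of_node h2 h3
      (e₁ := (1 : k) • e₁ + (0 : k) • e₂' + (-(a + ν * p) / (2 * b)) • e₃)
      (e₂ := (0 : k) • e₁ + (1 : k) • e₂' + (-q' / (2 * b)) • e₃)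
      (e₃ := (0 : k) • e₁ + (0 : k) • e₂' + (1 : k) • e₃) (r := r') hp hb
      ⟨?_, ?_, ?_, ?_, ?_, ?_, ?_, ?_, ?_, ?_⟩ <;>
      rw [h.comb, h111, k112, h113, k122, k123, h133, k222, k223, k233, h333, hν.2 hb]
    all_goals field_simp
    all_goals ring

/-- A cubic consisting of a line and a conic meeting it in two points. -/
theorem normalForm_of_secant (h2 : (2 : k) ≠ 0) {e₁ e₂ e₃ : V} {q b r d : k} (hb : b ≠ 0)
    (hv : CubicValues T e₁ e₂ e₃ 0 0 0 q b 0 r d 0 0) : HasCubicNormalForm T := by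
  obtain ⟨h111, h112, h113, h122, h123, h133, h222, h223, h233, h333⟩ := hv
  have e1 : e₁ = (1 : k) • e₁ + (0 : k) • e₂ + (0 : k) • e₃ := by simp
  have e3 : e₃ = (0 : k) • e₁ + (0 : k) • e₂ + (1 : k) • e₃ := by simp
  -- The cubic is `y` times a conic, and this vector is the pole of the line `y = 0` with respect to
  -- that conic. In the new coordinates the cubic is `y (6 b x z + r' y ^ 2)`.
  obtain ⟨e₂', he₂⟩ : ∃ x, x = (-d / (2 * b)) • e₁ + (1 : k) • e₂ + (-q / (2 * b)) • e₃ :=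
    ⟨_, rfl⟩
  obtain ⟨r', k222⟩ : ∃ x, T e₂' e₂' e₂' = x := ⟨_, rfl⟩
  have k112 : T e₁ e₁ e₂' = 0 := by
    rw [he₂]; nth_rw 1 2 [e1]
    rw [h.comb, h111, h112, h113, h122, h123, h133, h222, h223, h233, h333]; ring
  have k122 : T e₁ e₂' e₂' = 0 := by
    rw [he₂]; nth_rw 1 [e1]
    rw [h.comb, h111, h112, h113, h122, h123, h133, h222, h223, h233, h333]; field_simp; ring
  have k123 : T e₁ e₂' e₃ = b := by
    rw [he₂]; nth_rw 1 [e1]; nth_rw 3 [e3]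
    rw [h.comb, h111, h112, h113, h122, h123, h133, h222, h223, h233, h333]; ring
  have k223 : T e₂' e₂' e₃ = 0 := by
    rw [he₂]; nth_rw 3 [e3]
    rw [h.comb, h111, h112, h113, h122, h123, h133, h222, h223, h233, h333]; field_simp; ring
  have k233 : T e₂' e₃ e₃ = 0 := by
    rw [he₂]; nth_rw 2 3 [e3]
    rw [h.comb, h111, h112, h113, h122, h123, h133, h222, h223, h233, h333]; ring
  by_cases hr : r' = 0
  · exact ⟨e₁, e₂', e₃, b, hb, Or.inr <| Or.inr <| Or.inl
      ⟨h111, k112, h113, k122, k123, h133, k222.trans hr, k223, k233, h333⟩⟩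
  · refine ⟨(-r' / (2 * b)) • e₁ + (0 : k) • e₂' + (0 : k) • e₃,
      (0 : k) • e₁ + (0 : k) • e₂' + (1 : k) • e₃, (0 : k) • e₁ + (1 : k) • e₂' + (0 : k) • e₃,
      -r' / 2, div_ne_zero (neg_ne_zero.mpr hr) h2, Or.inr <| Or.inl ?_⟩
    refine ⟨?_, ?_, ?_, ?_, ?_, ?_, ?_, ?_, ?_, ?_⟩ <;>
      rw [h.comb, h111, k112, h113, k122, k123, h133, k222, k223, k233, h333]
    all_goals field_simp
    all_goals ring

/-- A cubic consisting of a line and a conic touching it. -/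
theorem normalForm_of_tangent (h2 : (2 : k) ≠ 0) (h3 : (3 : k) ≠ 0) {e₁ e₂ e₃ : V}
    {a q r d : k} (ha : a ≠ 0) (hd : d ≠ 0)
    (hv : CubicValues T e₁ e₂ e₃ 0 a 0 q 0 0 r d 0 0) : HasCubicNormalForm T := by
  obtain ⟨h111, h112, h113, h122, h123, h133, h222, h223, h233, h333⟩ := hv
  refine ⟨(0 : k) • e₁ + (0 : k) • e₂ + (-a / (2 * d)) • e₃,
    (1 : k) • e₁ + (0 : k) • e₂ + (-q / d) • e₃, (0 : k) • e₁ + (1 : k) • e₂ + (-r / (3 * d)) • e₃,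
    -a / 2, div_ne_zero (neg_ne_zero.mpr ha) h2, ?_⟩
  refine Or.inr <| Or.inr <| Or.inr <| Or.inr <| Or.inr ?_
  refine ⟨?_, ?_, ?_, ?_, ?_, ?_, ?_, ?_, ?_, ?_⟩ <;>
    rw [h.comb, h111, h112, h113, h122, h123, h133, h222, h223, h233, h333]
  all_goals field_simp
  all_goals ring

/-- A vector of the span of `e₁, e₂, e₃` that is killed by all pairs of these vectors is zero. -/
theorem eq_zero_of_values {e₁ e₂ e₃ : V} (hs : ∀ v : V, ∃ a b c : k, v = a • e₁ + b • e₂ + c • e₃)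
    (hT : ∀ v : V, (∀ y z, T v y z = 0) → v = 0) {v : V} (h11 : T v e₁ e₁ = 0)
    (h12 : T v e₁ e₂ = 0) (h13 : T v e₁ e₃ = 0) (h22 : T v e₂ e₂ = 0) (h23 : T v e₂ e₃ = 0)
    (h33 : T v e₃ e₃ = 0) : v = 0 := by
  refine hT v fun y z ↦ ?_
  obtain ⟨a, b, c, rfl⟩ := hs y
  obtain ⟨a', b', c', rfl⟩ := hs z
  rw [h.comb_mid, h.comb_right, h.comb_right, h.comb_right, h11, h12, h13, h.swap_right v e₂ e₁,
    h12, h22, h23, h.swap_right v e₃ e₁, h13, h.swap_right v e₃ e₂, h23, h33]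
  ring

/-- A nondegenerate cubic containing a line. -/
theorem normalForm_of_line [IsAlgClosed k] (h2 : (2 : k) ≠ 0) (h3 : (3 : k) ≠ 0)
    {e₁ e₂ e₃ : V} (hs : ∀ v : V, ∃ a b c : k, v = a • e₁ + b • e₂ + c • e₃)
    (hi : ∀ a b c : k, a • e₁ + b • e₂ + c • e₃ = 0 → a = 0 ∧ b = 0 ∧ c = 0)
    (hT : ∀ v : V, (∀ y z, T v y z = 0) → v = 0) {a q b r d t : k}
    (hv : CubicValues T e₁ e₂ e₃ 0 a 0 q b 0 r d t 0) : HasCubicNormalForm T := by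
  -- The condition `t = 0` says that `e₃` is a point where the line `y = 0` meets the residual
  -- conic. Such a point `x • e₁ + y • e₃` exists, and `t ≠ 0` forces `x ≠ 0`, so it can replace
  -- `e₁` in the basis; the roles of the first and third vectors are then exchanged.
  wlog ht : t = 0 generalizing e₁ e₂ e₃ a q b r d t
  · obtain ⟨h111, h112, h113, h122, h123, h133, h222, h223, h233, h333⟩ := hv
    obtain ⟨x, y, hxy, hq⟩ := exists_isotropic a (2 * b) t
    have hx : x ≠ 0 := by
      rintro rfl
      have hy : y ≠ 0 := by simpa using hxy
      simp [hy, ht] at hq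
    refine this (e₁ := (0 : k) • e₁ + (0 : k) • e₂ + (1 : k) • e₃)
      (e₂ := (0 : k) • e₁ + (1 : k) • e₂ + (0 : k) • e₃)
      (e₃ := x • e₁ + (0 : k) • e₂ + y • e₃) (t := 0) (fun v ↦ ?_) (fun a' b' c' h0 ↦ ?_)
      ⟨?_, rfl, ?_, rfl, rfl, ?_, rfl, rfl, ?_, ?_⟩ rfl
    · obtain ⟨a', b', c', rfl⟩ := hs v
      refine ⟨c' - a' / x * y, b', a' / x, ?_⟩
      have : a' • e₁ = (a' / x * x) • e₁ := by rw [div_mul_cancel₀ _ hx]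
      rw [this]
      module
    · obtain ⟨h₁, h₂, h₃⟩ := hi (c' * x) b' (a' + c' * y) (by rw [← h0]; module)
      have hc : c' = 0 := (mul_eq_zero.mp h₁).resolve_right hx
      exact ⟨by simpa [hc] using h₃, h₂, hc⟩
    all_goals
      rw [h.comb, h111, h112, h113, h122, h123, h133, h222, h223, h233, h333]
    · ring
    · ring
    · ring
    · linear_combination hq
    · ring
  subst ht
  have hv' := hv
  obtain ⟨h111, h112, h113, h122, h123, h133, h222, h223, h233, h333⟩ := hv
  have e1 : e₁ = (1 : k) • e₁ + (0 : k) • e₂ + (0 : k) • e₃ := by simp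
  have e2 : e₂ = (0 : k) • e₁ + (1 : k) • e₂ + (0 : k) • e₃ := by simp
  have e3 : e₃ = (0 : k) • e₁ + (0 : k) • e₂ + (1 : k) • e₃ := by simp
  -- On the line `y = 0` the residual conic restricts to `3 x (a x + 2 b z)`. The line is a tangent
  -- for `b = 0` and a secant otherwise.
  by_cases hb : b = 0
  · subst hb
    have hd : d ≠ 0 := by
      rintro rfl
      have : e₃ = 0 := by
        refine h.eq_zero_of_values hs hT ?_ ?_ ?_ ?_ ?_ ?_
        · rw [h.swap_left, h.swap_right, h113]
        · rw [h.swap_left, h.swap_right, h123]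
        · rw [h.swap_left, h133]
        · rw [h.swap_left, h.swap_right, h223]
        · rw [h.swap_left, h233]
        · exact h333
      exact one_ne_zero (hi 0 0 1 (by simp [this])).2.2
    have ha : a ≠ 0 := by
      rintro rfl
      -- With `a = b = 0` the cubic is `3 q x y ^ 2 + r y ^ 3 + 3 d y ^ 2 z`, a cone with this
      -- vector as vertex.
      have : d • e₁ + (0 : k) • e₂ + (-q) • e₃ = 0 := by
        refine h.eq_zero_of_values hs hT ?_ ?_ ?_ ?_ ?_ ?_
        · nth_rw 2 3 [e1]
          rw [h.comb, h111, h112, h113, h122, h123, h133, h222, h223, h233, h333]; ring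
        · nth_rw 2 [e1]; nth_rw 3 [e2]
          rw [h.comb, h111, h112, h113, h122, h123, h133, h222, h223, h233, h333]; ring
        · nth_rw 2 [e1]; nth_rw 3 [e3]
          rw [h.comb, h111, h112, h113, h122, h123, h133, h222, h223, h233, h333]; ring
        · nth_rw 2 3 [e2]
          rw [h.comb, h111, h112, h113, h122, h123, h133, h222, h223, h233, h333]; ring
        · nth_rw 2 [e2]; nth_rw 3 [e3]
          rw [h.comb, h111, h112, h113, h122, h123, h133, h222, h223, h233, h333]; ring
        · nth_rw 2 3 [e3]
          rw [h.comb, h111, h112, h113, h122, h123, h133, h222, h223, h233, h333]; ring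
      exact hd (hi _ _ _ this).1
    exact h.normalForm_of_tangent h2 h3 ha hd hv'
  · refine h.normalForm_of_secant h2
      (e₁ := (1 : k) • e₁ + (0 : k) • e₂ + (-a / (2 * b)) • e₃)
      (e₂ := (0 : k) • e₁ + (1 : k) • e₂ + (0 : k) • e₃)
      (e₃ := (0 : k) • e₁ + (0 : k) • e₂ + (1 : k) • e₃) hb
      ⟨?_, ?_, ?_, rfl, ?_, ?_, rfl, rfl, ?_, ?_⟩ <;>
      rw [h.comb, h111, h112, h113, h122, h123, h133, h222, h223, h233, h333]
    all_goals field_simp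
    all_goals ring

/-- A nondegenerate cubic together with a point and a line that meet as at a flex. -/
theorem normalForm_of_flex [IsAlgClosed k] (h2 : (2 : k) ≠ 0) (h3 : (3 : k) ≠ 0)
    {e₁ e₂ e₃ : V} (hs : ∀ v : V, ∃ a b c : k, v = a • e₁ + b • e₂ + c • e₃)
    (hi : ∀ a b c : k, a • e₁ + b • e₂ + c • e₃ = 0 → a = 0 ∧ b = 0 ∧ c = 0)
    (hT : ∀ v : V, (∀ y z, T v y z = 0) → v = 0)
    (h113 : T e₁ e₁ e₃ = 0) (h133 : T e₁ e₃ e₃ = 0) (h333 : T e₃ e₃ e₃ = 0) :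
    HasCubicNormalForm T := by
  -- On the line through `e₁` and `e₃` the cubic restricts to a multiple of `x ^ 3`. If this
  -- multiple is 0 the cubic contains the line. Otherwise `T e₂ e₃ e₃` decides whether `e₃` is
  -- singular.
  by_cases hp : T e₁ e₁ e₁ = 0
  · exact h.normalForm_of_line h2 h3 hs hi hT ⟨hp, rfl, h113, rfl, rfl, h133, rfl, rfl, rfl, h333⟩
  by_cases ht : T e₂ e₃ e₃ = 0
  · refine h.normalForm_of_singular_flex h2 h3 hp ?_
      ⟨rfl, rfl, h113, rfl, rfl, h133, rfl, rfl, ht, h333⟩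
    by_contra! hcon
    have : e₃ = 0 := by
      refine h.eq_zero_of_values hs hT ?_ ?_ ?_ ?_ ?_ ?_
      · rw [h.swap_left, h.swap_right, h113]
      · rw [h.swap_left, h.swap_right, hcon.1]
      · rw [h.swap_left, h133]
      · rw [h.swap_left, h.swap_right, hcon.2]
      · rw [h.swap_left, ht]
      · exact h333
    exact one_ne_zero (hi 0 0 1 (by simp [this])).2.2
  · exact h.normalForm_of_smooth_flex h2 h3 hp ht
      ⟨rfl, rfl, h113, rfl, rfl, h133, rfl, rfl, rfl, h333⟩

end IsSymmTrilinear

end TernaryCubics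

/-! ### Classification of nondegenerate ternary cubics by means of the Hessian. -/

section TernaryCubics

variable {k V : Type*} [Field k] [AddCommGroup V] [Module k V]

theorem linearIndependent_triple_iff {e₁ e₂ e₃ : V} :
    LinearIndependent k ![e₁, e₂, e₃] ↔
      ∀ a b c : k, a • e₁ + b • e₂ + c • e₃ = 0 → a = 0 ∧ b = 0 ∧ c = 0 := by
  rw [Fintype.linearIndependent_iff]
  constructor
  · intro h a b c h0
    have := h ![a, b, c] (by simpa [Fin.sum_univ_three] using h0)
    exact ⟨this 0, this 1, this 2⟩
  · intro h g hg i
    obtain ⟨h0, h1, h2⟩ := h (g 0) (g 1) (g 2) (by simpa [Fin.sum_univ_three] using hg)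
    fin_cases i <;> assumption

theorem exists_eq_comb_of_finrank_eq_three (hV : Module.finrank k V = 3) {e₁ e₂ e₃ : V}
    (hi : LinearIndependent k ![e₁, e₂, e₃]) (v : V) :
    ∃ a b c : k, v = a • e₁ + b • e₂ + c • e₃ := by
  have : Module.Finite k V := Module.finite_of_finrank_pos (by omega)
  have htop := hi.span_eq_top_of_card_eq_finrank (by simp [hV])
  have hv : v ∈ Submodule.span k (Set.range ![e₁, e₂, e₃]) := htop ▸ Submodule.mem_top
  obtain ⟨c, hc⟩ := (Submodule.mem_span_range_iff_exists_fun k).mp hv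
  exact ⟨c 0, c 1, c 2, by rw [← hc, Fin.sum_univ_three]; rfl⟩

theorem exists_linearIndependent_triple (hV : Module.finrank k V = 3) {v w : V}
    (h : LinearIndependent k ![v, w]) : ∃ x, LinearIndependent k ![x, v, w] :=
  exists_linearIndependent_cons_of_lt_finrank h (by omega)

theorem exists_linearIndependent_pair (hV : Module.finrank k V = 3) {v : V} (h : v ≠ 0) :
    ∃ x, LinearIndependent k ![x, v] :=
  exists_linearIndependent_cons_of_lt_finrank (v := ![v])
    (LinearIndependent.of_subsingleton (0 : Fin 1) h) (by omega)

namespace IsSymmTrilinear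

variable {T : V → V → V → k} (h : IsSymmTrilinear T)
include h

theorem add_mid (x y y' z : V) : T x (y + y') z = T x y z + T x y' z := by
  simp only [h.swap_left x, h.add_left]

theorem add_right (x y z z' : V) : T x y (z + z') = T x y z + T x y z' := by
  simp only [h.swap_right x y, h.add_mid]

theorem smul_mid (a : k) (x y z : V) : T x (a • y) z = a * T x y z := by
  rw [h.swap_left, h.smul_left, h.swap_left]

theorem smul_right (a : k) (x y z : V) : T x y (a • z) = a * T x y z := by
  rw [h.swap_right, h.smul_mid, h.swap_right]

open MvPolynomial in
/-- Every ternary cubic has a zero at which its Hessian matrix is degenerate. -/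
theorem exists_hessian_degenerate [IsAlgClosed k] {e₁ e₂ e₃ : V}
    (hi : LinearIndependent k ![e₁, e₂, e₃])
    (hs : ∀ v : V, ∃ a b c : k, v = a • e₁ + b • e₂ + c • e₃) :
    ∃ v w : V, v ≠ 0 ∧ w ≠ 0 ∧ T v v v = 0 ∧ ∀ y, T v y w = 0 := by
  rw [linearIndependent_triple_iff] at hi
  let e : Fin 3 → V := ![e₁, e₂, e₃]
  -- `P` is the matrix of the bilinear form `T x · ·` for a generic `x`. Its determinant is the
  -- Hessian up to a constant, and `f` is the cubic itself. At a common zero, a kernel vector of the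
  -- matrix gives `w`.
  let P : Matrix (Fin 3) (Fin 3) (MvPolynomial (Fin 3) k) := Matrix.of fun i j ↦
    C (T e₁ (e i) (e j)) * X 0 + C (T e₂ (e i) (e j)) * X 1 + C (T e₃ (e i) (e j)) * X 2
  let f : MvPolynomial (Fin 3) k := ∑ i, ∑ j, X i * X j * P i j
  have hP0 (i j : Fin 3) : constantCoeff (P i j) = 0 := by simp [P]
  have hP (a : Fin 3 → k) (i j : Fin 3) :
      eval a (P i j) = T (a 0 • e₁ + a 1 • e₂ + a 2 • e₃) (e i) (e j) := by
    rw [h.comb_left]; simp [P]; ring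
  classical
  obtain ⟨a, ha, hz⟩ := exists_ne_zero_common_zero {f, P.det}
    (Finset.card_le_two.trans_lt (by norm_num)) (by
      intro p hp
      rw [Finset.mem_insert, Finset.mem_singleton] at hp
      rcases hp with rfl | rfl
      · simp [f]
      · simp [Matrix.det_fin_three, hP0])
  have hf : eval a f = 0 := hz f (by simp)
  have hd : eval a P.det = 0 := hz P.det (by simp)
  have hd' : (P.map (eval a)).det = 0 := by
    rw [← hd, RingHom.map_det]; rfl
  obtain ⟨b, hb, hPb⟩ := Matrix.exists_mulVec_eq_zero_iff.mpr hd'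
  have hne (c : Fin 3 → k) (hc : c ≠ 0) : c 0 • e₁ + c 1 • e₂ + c 2 • e₃ ≠ 0 := by
    intro h0
    obtain ⟨h₁, h₂, h₃⟩ := hi _ _ _ h0
    exact hc (funext fun i ↦ by fin_cases i <;> assumption)
  refine ⟨a 0 • e₁ + a 1 • e₂ + a 2 • e₃, b 0 • e₁ + b 1 • e₂ + b 2 • e₃, hne a ha, hne b hb,
    ?_, ?_⟩
  · have hfe : eval a f = ∑ i, ∑ j, a i * a j * eval a (P i j) := by
      simp only [f, map_sum, map_mul, eval_X]
    have hcomb (v : V) : T v (a 0 • e₁ + a 1 • e₂ + a 2 • e₃) (a 0 • e₁ + a 1 • e₂ + a 2 • e₃) =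
        ∑ i, ∑ j, a i * a j * T v (e i) (e j) := by
      rw [h.comb_mid, h.comb_right, h.comb_right, h.comb_right]
      simp only [Fin.sum_univ_three, e, Matrix.cons_val]
      ring
    rw [hcomb, ← hf, hfe]
    simp only [hP]
  · intro y
    have key (i : Fin 3) :
        T (a 0 • e₁ + a 1 • e₂ + a 2 • e₃) (e i) (b 0 • e₁ + b 1 • e₂ + b 2 • e₃) = 0 := by
      have := congrFun hPb i
      simp only [Matrix.mulVec, dotProduct, Fin.sum_univ_three, Matrix.map_apply, hP,
        Pi.zero_apply] at this
      rw [h.comb_right, ← this]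
      simp only [e, Matrix.cons_val]
      ring
    obtain ⟨c₁, c₂, c₃, rfl⟩ := hs y
    rw [h.comb_mid, show T _ e₁ _ = 0 from key 0, show T _ e₂ _ = 0 from key 1,
      show T _ e₃ _ = 0 from key 2]
    ring

/-- Normal forms of nondegenerate ternary cubics over an algebraically closed field of
characteristic different from `2` and `3`. -/
theorem hasCubicNormalForm [IsAlgClosed k] (h2 : (2 : k) ≠ 0) (h3 : (3 : k) ≠ 0)
    (hV : Module.finrank k V = 3) (hT : ∀ v : V, (∀ y z, T v y z = 0) → v = 0) :
    HasCubicNormalForm T := by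
  have : Module.Finite k V := Module.finite_of_finrank_pos (by omega)
  let B := Module.finBasisOfFinrankEq k V hV
  have hB : LinearIndependent k ![B 0, B 1, B 2] := by
    convert B.linearIndependent using 1
    ext i
    fin_cases i <;> rfl
  obtain ⟨v, w, hv, hw, hvv, hvw⟩ :=
    h.exists_hessian_degenerate hB (exists_eq_comb_of_finrank_eq_three hV hB)
  -- If `w` is not proportional to `v`, the line through both meets the cubic at `v` as at a flex
  -- tangent, since all values `T v w ·` vanish.
  by_cases hvwi : LinearIndependent k ![w, v]
  · obtain ⟨x, hx⟩ := exists_linearIndependent_triple hV hvwi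
    have hx' : LinearIndependent k ![w, x, v] := by
      rw [linearIndependent_triple_iff] at hx ⊢
      intro a b c h0
      obtain ⟨h₁, h₂, h₃⟩ := hx b a c (by rw [← h0]; abel)
      exact ⟨h₂, h₁, h₃⟩
    refine h.normalForm_of_flex h2 h3 (exists_eq_comb_of_finrank_eq_three hV hx')
      (linearIndependent_triple_iff.mp hx') hT ?_ ?_ hvv
    · rw [h.swap_right, h.swap_left, hvw]
    · rw [h.swap_left, h.swap_right, hvw]
  -- Here `v` is a singular point, and any isotropic direction of `T v · ·` in a complement of `v`
  -- serves as the tangent.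
  · have hvv' : ∀ y, T v y v = 0 := by
      rw [LinearIndependent.pair_iff' hw] at hvwi
      push Not at hvwi
      obtain ⟨c, rfl⟩ := hvwi
      intro y
      rw [h.smul_right, hvw, mul_zero]
    obtain ⟨x, hx⟩ := exists_linearIndependent_pair hV hv
    obtain ⟨y, hy⟩ := exists_linearIndependent_triple hV hx
    obtain ⟨a, b, hab, hq⟩ := exists_isotropic (T v x x) (2 * T v x y) (T v y y)
    have hyi := linearIndependent_triple_iff.mp hy
    have hiso : T (a • x + b • y) (a • x + b • y) v = 0 := by
      rw [h.swap_right, h.swap_left, h.swap_right v, h.add_mid, h.add_right, h.add_right]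
      simp only [h.smul_mid, h.smul_right]
      rw [← hq, h.swap_right v y x]
      ring
    obtain ⟨z, hz⟩ : ∃ z, LinearIndependent k ![z, a • x + b • y, v] := by
      refine exists_linearIndependent_triple hV (LinearIndependent.pair_iff.mpr fun s t h0 ↦ ?_)
      obtain ⟨h₁, h₂, h₃⟩ := hyi (s * b) (s * a) t (by rw [← h0]; module)
      refine ⟨?_, h₃⟩
      rcases hab with hab | hab
      · exact (mul_eq_zero.mp h₂).resolve_right hab
      · exact (mul_eq_zero.mp h₁).resolve_right hab
    have hz' : LinearIndependent k ![a • x + b • y, z, v] := by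
      rw [linearIndependent_triple_iff] at hz ⊢
      intro a b c h0
      obtain ⟨h₁, h₂, h₃⟩ := hz b a c (by rw [← h0]; abel)
      exact ⟨h₂, h₁, h₃⟩
    refine h.normalForm_of_flex h2 h3 (exists_eq_comb_of_finrank_eq_three hV hz')
      (linearIndependent_triple_iff.mp hz') hT hiso ?_ hvv
    rw [h.swap_left, hvv']

/-- The vectors on which a form takes the values of a normal form are linearly independent. -/
theorem linearIndependent_of_normalForm (h2 : (2 : k) ≠ 0) {e₁ e₂ e₃ : V} {c : k} (hc : c ≠ 0)
    (hn : IsCubicNormalForm T e₁ e₂ e₃ c) : LinearIndependent k ![e₁, e₂, e₃] := by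
  rw [linearIndependent_triple_iff]
  intro x y z h0
  have e1 : e₁ = (1 : k) • e₁ + (0 : k) • e₂ + (0 : k) • e₃ := by simp
  have e2 : e₂ = (0 : k) • e₁ + (1 : k) • e₂ + (0 : k) • e₃ := by simp
  have e3 : e₃ = (0 : k) • e₁ + (0 : k) • e₂ + (1 : k) • e₃ := by simp
  -- Contracting the linear relation with the six pairs of vectors gives linear equations whose
  -- coefficients are read off from the normal form.
  have key (v w : V) : x * T e₁ v w + y * T e₂ v w + z * T e₃ v w = 0 := by
    rw [← h.comb_left, h0, h.zero_left]
  have k11 := key e₁ e₁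
  have k12 := key e₁ e₂
  have k13 := key e₁ e₃
  have k22 := key e₂ e₂
  have k23 := key e₂ e₃
  have k33 := key e₃ e₃
  rw [h.swap_left e₂ e₁ e₁, h.swap_right e₁ e₂ e₁, h.swap_left e₃ e₁ e₁, h.swap_right e₁ e₃ e₁]
    at k11
  rw [h.swap_left e₂ e₁ e₂, h.swap_left e₃ e₁ e₂, h.swap_right e₁ e₃ e₂] at k12
  rw [h.swap_left e₂ e₁ e₃, h.swap_left e₃ e₁ e₃] at k13
  rw [h.swap_left e₃ e₂ e₂, h.swap_right e₂ e₃ e₂] at k22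
  rw [h.swap_left e₃ e₂ e₃] at k23
  rcases hn with ⟨α, hv⟩ | hv | hv | hv | hv | hv <;>
    obtain ⟨h111, h112, h113, h122, h123, h133, h222, h223, h233, h333⟩ := hv <;>
    rw [h111, h112, h113] at k11 <;> rw [h112, h122, h123] at k12 <;>
    rw [h113, h123, h133] at k13 <;> rw [h122, h222, h223] at k22 <;>
    rw [h123, h223, h233] at k23 <;> rw [h133, h233, h333] at k33 <;>
    refine ⟨?_, ?_, ?_⟩ <;> grind

end IsSymmTrilinear

end TernaryCubics

/-! ### Finite self-injective dimension implies self-injectivity when the maximal ideal is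
nilpotent. -/

section SelfInjective

open CategoryTheory Abelian IsLocalRing

variable {A : Type u} [CommRing A] [IsLocalRing A]

/-- If the socle of a local ring is nonzero, then every module killed by the maximal ideal embeds
into a free module. -/
theorem exists_injective_of_maximalIdeal_smul_eq_zero {s : A} (hs0 : s ≠ 0)
    (hs : ∀ a ∈ maximalIdeal A, a * s = 0) (Y : Type u) [AddCommGroup Y] [Module A Y]
    (hY : ∀ a ∈ maximalIdeal A, ∀ y : Y, a • y = 0) :
    ∃ (ι : Type u) (f : Y →ₗ[A] ι →₀ A), Function.Injective f := by
  let k := A ⧸ maximalIdeal A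
  let : Field k := Ideal.Quotient.field _
  have htors : Module.IsTorsionBySet A Y (maximalIdeal A) := fun y a ↦ hY a a.2 y
  let : Module k Y := htors.module
  have : IsScalarTower A k Y := htors.isScalarTower
  let b := Module.Free.chooseBasis k Y
  -- The residue field embeds as the submodule `A s`, and a module killed by the maximal ideal is a
  -- direct sum of copies of it.
  let σ : k →ₗ[A] A := Submodule.liftQ (maximalIdeal A) (LinearMap.toSpanSingleton A A s)
    fun a ha ↦ by simpa using hs a ha
  have hσ : Function.Injective σ := by
    rw [injective_iff_map_eq_zero]
    intro x hx
    obtain ⟨a, rfl⟩ := Ideal.Quotient.mk_surjective x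
    have hx' : a * s = 0 := hx
    rw [Ideal.Quotient.eq_zero_iff_mem]
    by_contra ha
    rw [mem_maximalIdeal, mem_nonunits_iff, not_not] at ha
    exact hs0 ((ha.mul_right_eq_zero).mp hx')
  refine ⟨Module.Free.ChooseBasisIndex k Y,
    (Finsupp.mapRange.linearMap σ).comp (b.repr.toLinearMap.restrictScalars A), ?_⟩
  rw [LinearMap.coe_comp]
  refine Function.Injective.comp ?_ b.repr.injective
  exact Finsupp.mapRange_injective σ (map_zero σ) hσ

/-- Embed `Y` into a free module `F` with cokernel `C`. In the long exact sequence, `Ext Y X (d +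
1)` lies between `Ext F X (d + 1)`, which vanishes because `F` is projective, and `Ext C X (d + 2)`,
which vanishes by the bound on the injective dimension. -/
theorem ext_eq_zero_of_maximalIdeal_smul_eq_zero {s : A} (hs0 : s ≠ 0)
    (hs : ∀ a ∈ maximalIdeal A, a * s = 0) (X : ModuleCat.{u} A) (d : ℕ)
    (hX : HasInjectiveDimensionLT X (d + 2)) (Y : ModuleCat.{u} A)
    (hY : ∀ a ∈ maximalIdeal A, ∀ y : Y, a • y = 0) (e : Ext Y X (d + 1)) : e = 0 := by
  obtain ⟨ι, f, hf⟩ := exists_injective_of_maximalIdeal_smul_eq_zero hs0 hs Y hY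
  let S : ShortComplex (ModuleCat.{u} A) :=
    ModuleCat.shortComplexOfCompEqZero _ _ f.exact_map_mkQ_range.linearMap_comp_eq_zero
  have hS : S.ShortExact := ModuleCat.shortComplex_shortExact S
    f.exact_map_mkQ_range hf (Submodule.mkQ_surjective _)
  have hproj : Projective S.X₂ := ModuleCat.projective_of_free (Module.Free.chooseBasis A (ι →₀ A))
  obtain ⟨x, rfl⟩ := Ext.contravariant_sequence_exact₁ hS X e (n₁ := d + 2) (by omega)
    (Ext.eq_zero_of_hasInjectiveDimensionLT _ (d + 2) le_rfl)
  rw [Ext.eq_zero_of_projective x, Ext.comp_zero]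

/-- Dévissage along `0 → M Y → Y → Y / M Y → 0`: the submodule is killed by a smaller power of `M`,
the quotient by `M`. -/
theorem ext_eq_zero_of_maximalIdeal_pow_smul_eq_zero {s : A} (hs0 : s ≠ 0)
    (hs : ∀ a ∈ maximalIdeal A, a * s = 0) (X : ModuleCat.{u} A) (d : ℕ)
    (hX : HasInjectiveDimensionLT X (d + 2)) (N : ℕ) (Y : ModuleCat.{u} A)
    (hY : ∀ a ∈ maximalIdeal A ^ N, ∀ y : Y, a • y = 0) (e : Ext Y X (d + 1)) : e = 0 := by
  induction N generalizing Y with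
  | zero =>
    refine ext_eq_zero_of_maximalIdeal_smul_eq_zero hs0 hs X d hX Y (fun a _ y ↦ ?_) e
    have : y = 0 := by simpa using hY 1 (by simp) y
    rw [this, smul_zero]
  | succ N ih =>
    let W : Submodule A Y := maximalIdeal A • ⊤
    let S : ShortComplex (ModuleCat.{u} A) :=
      ModuleCat.shortComplexOfCompEqZero W.subtype W.mkQ (by ext x; simp)
    have hS : S.ShortExact := ModuleCat.shortComplex_shortExact S
      (LinearMap.exact_subtype_mkQ W) W.subtype_injective W.mkQ_surjective
    have h1 : (Ext.mk₀ S.f).comp e (zero_add (d + 1)) = 0 := by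
      refine ih S.X₁ (fun a ha y ↦ ?_) _
      obtain ⟨y, hy⟩ : W := y
      refine Subtype.ext ?_
      change a • y = 0
      refine Submodule.smul_induction_on hy (fun b hb z _ ↦ ?_) fun z z' hz hz' ↦ ?_
      · rw [smul_smul]
        exact hY _ (by rw [pow_succ]; exact Ideal.mul_mem_mul ha hb) z
      · rw [smul_add, hz, hz', add_zero]
    obtain ⟨x, rfl⟩ := Ext.contravariant_sequence_exact₂ hS X e h1
    rw [ext_eq_zero_of_maximalIdeal_smul_eq_zero hs0 hs X d hX S.X₃ ?_ x, Ext.comp_zero]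
    intro a ha y
    obtain ⟨y, rfl⟩ := W.mkQ_surjective y
    change a • W.mkQ y = 0
    rw [← map_smul, Submodule.mkQ_apply, Submodule.Quotient.mk_eq_zero]
    exact Submodule.smul_mem_smul ha trivial

/-- A local ring with nilpotent maximal ideal and of finite self-injective dimension is
self-injective. -/
theorem injective_of_hasInjectiveDimensionLE {N : ℕ} (hN : maximalIdeal A ^ N = ⊥) {s : A}
    (hs0 : s ≠ 0) (hs : ∀ a ∈ maximalIdeal A, a * s = 0) (d : ℕ)
    (hd : HasInjectiveDimensionLE (ModuleCat.of A A) d) : Module.Injective A A := by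
  induction d with
  | zero =>
    have : Injective (ModuleCat.of A A) := injective_iff_hasInjectiveDimensionLT_one.mpr hd
    exact Module.injective_module_of_injective_object A A
  | succ d ih =>
    -- Since `M ^ N = 0` kills every module, the vanishing holds for all `Y`, and the bound on the
    -- injective dimension drops by one.
    refine ih (hasInjectiveDimensionLT_of_enoughProjectives _ _ fun Y ↦
      subsingleton_of_forall_eq 0 fun e ↦ ?_)
    refine ext_eq_zero_of_maximalIdeal_pow_smul_eq_zero hs0 hs _ d hd N Y (fun a ha y ↦ ?_) e
    rw [hN, Ideal.mem_bot] at ha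
    rw [ha, zero_smul]

/-- The socle of a self-injective local ring is generated by each of its nonzero elements. -/
theorem exists_eq_mul_of_injective [Module.Injective A A] {s t : A} (hs0 : s ≠ 0)
    (ht : ∀ a ∈ maximalIdeal A, a * t = 0) : ∃ c, t = c * s := by
  -- The annihilator of `s` lies in `M`, hence kills `t`, so `s ↦ t` is well defined on `A s ≅ A ⧸
  -- ker`. Injectivity extends it to `A`, where it is multiplication by some `c`.
  let g : (A ⧸ LinearMap.ker (LinearMap.toSpanSingleton A A s)) →ₗ[A] A :=
    Submodule.liftQ _ (LinearMap.toSpanSingleton A A t) fun a ha ↦ by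
      have ha' : a * s = 0 := by simpa using ha
      have : a ∈ maximalIdeal A := by
        rw [mem_maximalIdeal, mem_nonunits_iff]
        exact fun hu ↦ hs0 ((hu.mul_right_eq_zero).mp ha')
      simpa using ht a this
  let f : (A ⧸ LinearMap.ker (LinearMap.toSpanSingleton A A s)) →ₗ[A] A :=
    Submodule.liftQ _ (LinearMap.toSpanSingleton A A s) le_rfl
  have hf : Function.Injective f := LinearMap.ker_eq_bot.mp (Submodule.ker_liftQ_eq_bot' _ _ rfl)
  obtain ⟨φ, hφ⟩ := Module.Injective.out f hf g
  have := hφ (Submodule.Quotient.mk 1)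
  simp only [f, g, Submodule.liftQ_apply, LinearMap.toSpanSingleton_apply, one_smul] at this
  exact ⟨φ 1, by rw [← this, mul_comm, ← smul_eq_mul, ← map_smul, smul_eq_mul, mul_one]⟩

end SelfInjective

/-! ### Bases of the layers `M ^ t / M ^ (t + 1)` in terms of elements of the ring. -/

section HilbertFunction

open IsLocalRing

variable {A : Type u} [CommRing A] [IsLocalRing A]

/-- The family `w` generates `M ^ t` modulo `M ^ (t + 1)`. -/
def SpansLayer (t : ℕ) {m : ℕ} (w : Fin m → A) : Prop :=
  ∀ a ∈ maximalIdeal A ^ t, ∃ c : Fin m → A, a - ∑ i, c i * w i ∈ maximalIdeal A ^ (t + 1)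

/-- The family `w` is linearly independent modulo `M ^ (t + 1)`. -/
def IndepLayer (t : ℕ) {m : ℕ} (w : Fin m → A) : Prop :=
  ∀ c : Fin m → A, ∑ i, c i * w i ∈ maximalIdeal A ^ (t + 1) → ∀ i, c i ∈ maximalIdeal A

variable (A) in
/-- The layer `M ^ t / M ^ (t + 1)`. -/
abbrev Layer (t : ℕ) : Type u :=
  ↥(maximalIdeal A ^ t) ⧸ (maximalIdeal A • ⊤ : Submodule A ↥(maximalIdeal A ^ t))

theorem layer_mk_eq_zero_iff {t : ℕ} (a : ↥(maximalIdeal A ^ t)) :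
    (Submodule.Quotient.mk a : Layer A t) = 0 ↔ (a : A) ∈ maximalIdeal A ^ (t + 1) := by
  rw [Submodule.Quotient.mk_eq_zero, Submodule.mem_smul_top_iff, smul_eq_mul, ← pow_succ']

/-- The class of an element of `M ^ t` in `M ^ t / M ^ (t + 1)`. -/
abbrev layerMk {t : ℕ} {m : ℕ} (w : Fin m → A) (hw : ∀ i, w i ∈ maximalIdeal A ^ t) (i : Fin m) :
    Layer A t :=
  Submodule.Quotient.mk ⟨w i, hw i⟩

theorem sum_smul_layerMk {t m : ℕ} (w : Fin m → A) (hw : ∀ i, w i ∈ maximalIdeal A ^ t)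
    (c : Fin m → A) :
    ∑ i, (Ideal.Quotient.mk (maximalIdeal A) (c i)) • layerMk w hw i =
      Submodule.Quotient.mk ⟨∑ i, c i * w i,
        Ideal.sum_mem _ fun i _ ↦ Ideal.mul_mem_left _ _ (hw i)⟩ := by
  have : (⟨∑ i, c i * w i, Ideal.sum_mem _ fun i _ ↦ Ideal.mul_mem_left _ _ (hw i)⟩ :
      ↥(maximalIdeal A ^ t)) = ∑ i, c i • ⟨w i, hw i⟩ := by
    ext; simp
  rw [this, ← Submodule.mkQ_apply, map_sum]
  exact Finset.sum_congr rfl fun i _ ↦ rfl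

theorem indepLayer_iff {t m : ℕ} (w : Fin m → A) (hw : ∀ i, w i ∈ maximalIdeal A ^ t) :
    IndepLayer t w ↔ LinearIndependent (A ⧸ maximalIdeal A) (layerMk w hw) := by
  rw [Fintype.linearIndependent_iff]
  constructor
  · intro h g hg i
    choose c hc using fun i ↦ Ideal.Quotient.mk_surjective (g i)
    obtain rfl : (fun i ↦ Ideal.Quotient.mk (maximalIdeal A) (c i)) = g := funext hc
    rw [sum_smul_layerMk, layer_mk_eq_zero_iff] at hg
    exact Ideal.Quotient.eq_zero_iff_mem.mpr (h c hg i)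
  · intro h c hc i
    refine Ideal.Quotient.eq_zero_iff_mem.mp (h (fun i ↦ Ideal.Quotient.mk _ (c i)) ?_ i)
    rw [sum_smul_layerMk, layer_mk_eq_zero_iff]
    exact hc

theorem spansLayer_iff {t m : ℕ} (w : Fin m → A) (hw : ∀ i, w i ∈ maximalIdeal A ^ t) :
    SpansLayer t w ↔ ⊤ ≤ Submodule.span (A ⧸ maximalIdeal A) (Set.range (layerMk w hw)) := by
  constructor
  · intro h x _
    obtain ⟨a, rfl⟩ := Submodule.Quotient.mk_surjective _ x
    obtain ⟨c, hc⟩ := h a a.2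
    rw [Submodule.mem_span_range_iff_exists_fun]
    refine ⟨fun i ↦ Ideal.Quotient.mk _ (c i), ?_⟩
    rw [sum_smul_layerMk, eq_comm, ← sub_eq_zero, ← Submodule.Quotient.mk_sub,
      layer_mk_eq_zero_iff]
    exact hc
  · intro h a ha
    have := h (x := Submodule.Quotient.mk ⟨a, ha⟩) trivial
    rw [Submodule.mem_span_range_iff_exists_fun] at this
    obtain ⟨g, hg⟩ := this
    choose c hc using fun i ↦ Ideal.Quotient.mk_surjective (g i)
    obtain rfl : (fun i ↦ Ideal.Quotient.mk (maximalIdeal A) (c i)) = g := funext hc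
    rw [sum_smul_layerMk, eq_comm, ← sub_eq_zero, ← Submodule.Quotient.mk_sub,
      layer_mk_eq_zero_iff] at hg
    exact ⟨c, hg⟩

variable [IsNoetherianRing A]

theorem finite_layer (t : ℕ) : Module.Finite (A ⧸ maximalIdeal A) (Layer A t) := by
  have : Module.Finite A (Layer A t) := inferInstance
  exact Module.Finite.of_restrictScalars_finite A _ _

theorem le_localHilbertFunction {t m : ℕ} (w : Fin m → A) (hw : ∀ i, w i ∈ maximalIdeal A ^ t)
    (h : IndepLayer t w) : m ≤ localHilbertFunction A t := by
  let : Field (A ⧸ maximalIdeal A) := Ideal.Quotient.field _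
  have := finite_layer (A := A) t
  rw [localHilbertFunction]
  simpa using ((indepLayer_iff w hw).mp h).fintype_card_le_finrank

theorem localHilbertFunction_le {t m : ℕ} (w : Fin m → A) (hw : ∀ i, w i ∈ maximalIdeal A ^ t)
    (h : SpansLayer t w) : localHilbertFunction A t ≤ m := by
  let : Field (A ⧸ maximalIdeal A) := Ideal.Quotient.field _
  have := finite_layer (A := A) t
  have h1 := finrank_range_le_card (R := A ⧸ maximalIdeal A) (layerMk w hw)
  rw [Set.finrank, top_le_iff.mp ((spansLayer_iff w hw).mp h), finrank_top] at h1
  rw [localHilbertFunction]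
  simpa using h1

theorem indepLayer_of_spansLayer {t m : ℕ} (w : Fin m → A) (hw : ∀ i, w i ∈ maximalIdeal A ^ t)
    (h : SpansLayer t w) (hm : localHilbertFunction A t = m) : IndepLayer t w := by
  let : Field (A ⧸ maximalIdeal A) := Ideal.Quotient.field _
  have := finite_layer (A := A) t
  rw [indepLayer_iff w hw]
  exact linearIndependent_of_top_le_span_of_card_eq_finrank ((spansLayer_iff w hw).mp h)
    (by rw [Fintype.card_fin]; exact hm.symm)

theorem spansLayer_of_indepLayer {t m : ℕ} (w : Fin m → A) (hw : ∀ i, w i ∈ maximalIdeal A ^ t)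
    (h : IndepLayer t w) (hm : localHilbertFunction A t = m) : SpansLayer t w := by
  let : Field (A ⧸ maximalIdeal A) := Ideal.Quotient.field _
  have := finite_layer (A := A) t
  rw [spansLayer_iff w hw, top_le_iff]
  exact ((indepLayer_iff w hw).mp h).span_eq_top_of_card_eq_finrank'
    (by rw [Fintype.card_fin]; exact hm.symm)

theorem exists_basis_layer (t : ℕ) : ∃ w : Fin (localHilbertFunction A t) → A,
    (∀ i, w i ∈ maximalIdeal A ^ t) ∧ SpansLayer t w ∧ IndepLayer t w := by
  let : Field (A ⧸ maximalIdeal A) := Ideal.Quotient.field _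
  have := finite_layer (A := A) t
  unfold localHilbertFunction
  let b := Module.finBasis (A ⧸ maximalIdeal A) (Layer A t)
  choose w hw using fun i ↦ Submodule.Quotient.mk_surjective _ (b i)
  have hb : layerMk (fun i ↦ (w i : A)) (fun i ↦ (w i).2) = b := funext hw
  refine ⟨fun i ↦ (w i : A), fun i ↦ (w i).2, ?_, ?_⟩
  · rw [spansLayer_iff _ fun i ↦ (w i).2, hb]
    exact b.span_eq.ge
  · rw [indepLayer_iff _ fun i ↦ (w i).2, hb]
    exact b.linearIndependent

/-- Nakayama's lemma: a zero layer means `M ^ t = M * M ^ t`. -/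
theorem maximalIdeal_pow_eq_bot_of_localHilbertFunction_eq_zero {t : ℕ}
    (h : localHilbertFunction A t = 0) : maximalIdeal A ^ t = ⊥ := by
  obtain ⟨w, _, hs, _⟩ := exists_basis_layer (A := A) t
  refine Submodule.eq_bot_of_le_smul_of_le_jacobson_bot (maximalIdeal A) _
    (IsNoetherian.noetherian _) (fun a ha ↦ ?_) (maximalIdeal_le_jacobson _)
  obtain ⟨c, hc⟩ := hs a ha
  have : IsEmpty (Fin (localHilbertFunction A t)) := by rw [h]; infer_instance
  rwa [Fintype.sum_empty, sub_zero, pow_succ'] at hc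

end HilbertFunction

/-! ### Duality between `M / (0 : M ^ 2)` and `M ^ 2 / M ^ 3`. -/

section SocleDegreeThree

open IsLocalRing

variable {A : Type u} [CommRing A] [IsLocalRing A]

variable (A) in
/-- The maximal ideal `M` satisfies `M ^ 4 = 0`, and the socle is generated by the nonzero element
`s` of `M ^ 3`. -/
structure IsSocleGenerator (s : A) : Prop where
  pow_four : maximalIdeal A ^ 4 = ⊥
  mem : s ∈ maximalIdeal A ^ 3
  ne_zero : s ≠ 0
  exists_eq_mul : ∀ t : A, (∀ a ∈ maximalIdeal A, a * t = 0) → ∃ c, t = c * s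

namespace IsSocleGenerator

variable {s : A} (h : IsSocleGenerator A s)
include h

theorem mul_eq_zero_of_mem_pow {a b : A} (i j : ℕ) (hij : 4 ≤ i + j)
    (ha : a ∈ maximalIdeal A ^ i) (hb : b ∈ maximalIdeal A ^ j) : a * b = 0 := by
  have : a * b ∈ maximalIdeal A ^ 4 :=
    Ideal.pow_le_pow_right hij (by rw [pow_add]; exact Ideal.mul_mem_mul ha hb)
  rwa [h.pow_four, Ideal.mem_bot] at this

theorem mul_eq_zero {a : A} (ha : a ∈ maximalIdeal A) : a * s = 0 :=
  h.mul_eq_zero_of_mem_pow 1 3 le_rfl (by rwa [pow_one]) h.mem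

theorem mul_eq_zero_iff {a : A} : a * s = 0 ↔ a ∈ maximalIdeal A := by
  refine ⟨fun h0 ↦ ?_, h.mul_eq_zero⟩
  rw [mem_maximalIdeal, mem_nonunits_iff]
  exact fun hu ↦ h.ne_zero ((hu.mul_right_eq_zero).mp h0)

/-- Identifies the multiples of `s` with the residue field. This replaces a `k`-algebra structure on
`A`. -/
theorem mul_eq_mul_iff {a b : A} : a * s = b * s ↔ residue A a = residue A b := by
  rw [← sub_eq_zero, ← sub_mul, h.mul_eq_zero_iff, ← residue_eq_zero_iff, map_sub, sub_eq_zero]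

theorem exists_eq_mul_of_mem {a : A} (ha : a ∈ maximalIdeal A ^ 3) : ∃ c, a = c * s :=
  h.exists_eq_mul a fun b hb ↦ h.mul_eq_zero_of_mem_pow 1 3 le_rfl (by rwa [pow_one]) ha

theorem unit_mul {c : A} (hc : IsUnit c) : IsSocleGenerator A (c * s) where
  pow_four := h.pow_four
  mem := Ideal.mul_mem_left _ _ h.mem
  ne_zero := by
    rw [Ne, hc.mul_right_eq_zero]
    exact h.ne_zero
  exists_eq_mul t ht := by
    obtain ⟨d, rfl⟩ := h.exists_eq_mul t ht
    obtain ⟨v, rfl⟩ := hc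
    exact ⟨d * ↑v⁻¹, by rw [mul_assoc, Units.inv_mul_cancel_left]⟩

/-- An element of `M` killed by the elements `u j` is killed by `M ^ 2`. -/
theorem mul_eq_zero_of_spansLayer {u : Fin 3 → A} (hu : SpansLayer 2 u) {a : A}
    (ha : a ∈ maximalIdeal A)
    (hau : ∀ j, a * u j = 0) {b : A} (hb : b ∈ maximalIdeal A ^ 2) : a * b = 0 := by
  obtain ⟨c, hc⟩ := hu b hb
  have h1 : a * (b - ∑ i, c i * u i) = 0 :=
    h.mul_eq_zero_of_mem_pow 1 3 le_rfl (by rwa [pow_one]) hc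
  rw [mul_sub, sub_eq_zero] at h1
  rw [h1, Finset.mul_sum]
  exact Finset.sum_eq_zero fun i _ ↦ by rw [mul_left_comm, hau, mul_zero]

end IsSocleGenerator

/-- Triples `z` in `M` and `u` in `M ^ 2` that are dual with respect to the socle generator `s`. -/
structure IsDualSystem (s : A) (z u : Fin 3 → A) : Prop where
  mem_z : ∀ i, z i ∈ maximalIdeal A
  mem_u : ∀ i, u i ∈ maximalIdeal A ^ 2
  mul_eq : ∀ i j, z i * u j = if i = j then s else 0

theorem mul_mem_pow_two {a b : A} (ha : a ∈ maximalIdeal A) (hb : b ∈ maximalIdeal A) :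
    a * b ∈ maximalIdeal A ^ 2 := by
  rw [pow_two]; exact Ideal.mul_mem_mul ha hb

theorem mul_mul_mem_pow_three {a b c : A} (ha : a ∈ maximalIdeal A) (hb : b ∈ maximalIdeal A)
    (hc : c ∈ maximalIdeal A) : a * b * c ∈ maximalIdeal A ^ 3 := by
  rw [pow_succ]; exact Ideal.mul_mem_mul (mul_mem_pow_two ha hb) hc

theorem mul_mem_pow_three {a b : A} (ha : a ∈ maximalIdeal A) (hb : b ∈ maximalIdeal A ^ 2) :
    a * b ∈ maximalIdeal A ^ 3 := by
  rw [pow_succ']; exact Ideal.mul_mem_mul ha hb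

/-- If `M ^ 2 / M ^ 3` is three-dimensional, then dual systems exist. -/
theorem IsSocleGenerator.exists_isDualSystem [IsNoetherianRing A] {s : A}
    (h : IsSocleGenerator A s) (hH : localHilbertFunction A 2 = 3) :
    ∃ z u : Fin 3 → A, IsDualSystem s z u := by
  have hb := exists_basis_layer (A := A) 2
  rw [hH] at hb
  obtain ⟨w, hw, -, hind⟩ := hb
  let k := ResidueField A
  -- `W` is the set of functionals on `M ^ 2 / M ^ 3`, in the basis `w`, that are given by
  -- multiplication with elements of `M`. If it were a proper subspace, a linear form vanishing on
  -- it would lift to an element of `M ^ 2` killed by `M`, hence in the socle and so in `M ^ 3`,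
  -- against the independence of `w`.
  let W : Submodule k (Fin 3 → k) :=
    { carrier := {v | ∃ a ∈ maximalIdeal A, ∀ j, ∃ c, a * w j = c * s ∧ residue A c = v j}
      add_mem' := by
        rintro v v' ⟨a, ha, hv⟩ ⟨a', ha', hv'⟩
        refine ⟨a + a', add_mem ha ha', fun j ↦ ?_⟩
        obtain ⟨c, hc, hcv⟩ := hv j
        obtain ⟨c', hc', hcv'⟩ := hv' j
        exact ⟨c + c', by rw [add_mul, add_mul, hc, hc'], by simp [hcv, hcv']⟩
      zero_mem' := ⟨0, zero_mem _, fun j ↦ ⟨0, by simp, by simp⟩⟩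
      smul_mem' := by
        rintro r v ⟨a, ha, hv⟩
        obtain ⟨r, rfl⟩ := residue_surjective r
        refine ⟨r * a, Ideal.mul_mem_left _ _ ha, fun j ↦ ?_⟩
        obtain ⟨c, hc, hcv⟩ := hv j
        exact ⟨r * c, by rw [mul_assoc, hc, mul_assoc], by simp [hcv]⟩ }
  have hW : W = ⊤ := by
    by_contra hne
    obtain ⟨f, hf0, hf⟩ := W.exists_le_ker_of_lt_top (lt_top_iff_ne_top.mpr hne)
    choose c hc using fun j ↦ residue_surjective (f (Pi.single j 1))
    have hfv (v : Fin 3 → k) : f v = ∑ j, residue A (c j) * v j := by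
      conv_lhs => rw [LinearMap.pi_apply_eq_sum_univ f v]
      refine Finset.sum_congr rfl fun j _ ↦ ?_
      rw [hc, smul_eq_mul, mul_comm]
      congr 2
      ext i
      simp [Pi.single_apply, eq_comm]
    have hsoc : ∀ a ∈ maximalIdeal A, a * ∑ j, c j * w j = 0 := by
      intro a ha
      choose d hd using fun j ↦ h.exists_eq_mul_of_mem (mul_mem_pow_three ha (hw j))
      have h1 := hf (show (fun j ↦ residue A (d j)) ∈ W from ⟨a, ha, fun j ↦ ⟨d j, hd j, rfl⟩⟩)
      rw [LinearMap.mem_ker, hfv] at h1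
      have h2 : a * ∑ j, c j * w j = (∑ j, c j * d j) * s := by
        rw [Finset.mul_sum, Finset.sum_mul]
        refine Finset.sum_congr rfl fun j _ ↦ ?_
        rw [mul_left_comm, hd j, mul_assoc]
      rw [h2, h.mul_eq_zero_iff, ← residue_eq_zero_iff, map_sum]
      simpa using h1
    obtain ⟨e, he⟩ := h.exists_eq_mul _ hsoc
    have hcm := hind c (by rw [he]; exact Ideal.mul_mem_left _ _ h.mem)
    refine hf0 (LinearMap.ext fun v ↦ ?_)
    rw [hfv]
    exact Finset.sum_eq_zero fun j _ ↦ by rw [(residue_eq_zero_iff _).mpr (hcm j), zero_mul]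
  have hz (i : Fin 3) : ∃ a ∈ maximalIdeal A, ∀ j, a * w j = if i = j then s else 0 := by
    obtain ⟨a, ha, hv⟩ := hW.ge (Submodule.mem_top (x := (Pi.single i 1 : Fin 3 → k)))
    refine ⟨a, ha, fun j ↦ ?_⟩
    obtain ⟨c, hc, hcv⟩ := hv j
    rw [hc]
    split_ifs with hij
    · subst hij
      rw [Pi.single_eq_same, ← map_one (residue A), ← h.mul_eq_mul_iff, one_mul] at hcv
      exact hcv
    · rw [Pi.single_eq_of_ne (Ne.symm hij)] at hcv
      rw [h.mul_eq_zero_iff, ← residue_eq_zero_iff, hcv]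
  choose z hzm hzw using hz
  exact ⟨z, w, hzm, hw, hzw⟩

namespace IsDualSystem

variable {s : A} {z u : Fin 3 → A} (hs : IsSocleGenerator A s) (h : IsDualSystem s z u)
include h

theorem sum_mul_u (c : Fin 3 → A) (j : Fin 3) : (∑ i, c i * z i) * u j = c j * s := by
  rw [Finset.sum_mul, Finset.sum_eq_single j]
  · rw [mul_assoc, h.mul_eq, if_pos rfl]
  · intro i _ hij
    rw [mul_assoc, h.mul_eq, if_neg hij, mul_zero]
  · simp

theorem z_mul_sum (c : Fin 3 → A) (i : Fin 3) : z i * ∑ j, c j * u j = c i * s := by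
  rw [Finset.mul_sum, Finset.sum_eq_single i]
  · rw [mul_left_comm, h.mul_eq, if_pos rfl]
  · intro j _ hij
    rw [mul_left_comm, h.mul_eq, if_neg hij.symm, mul_zero]
  · simp

include hs

theorem spansLayer [IsNoetherianRing A] (hH : localHilbertFunction A 2 = 3) : SpansLayer 2 u := by
  refine spansLayer_of_indepLayer u h.mem_u (fun c hc i ↦ ?_) hH
  rw [← hs.mul_eq_zero_iff, ← h.z_mul_sum]
  exact hs.mul_eq_zero_of_mem_pow 1 3 le_rfl (by rw [pow_one]; exact h.mem_z i) hc

/-- Modulo the annihilator of `M ^ 2`, the ideal `M` is generated by the elements `z i`. -/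
theorem exists_sub_mul_eq_zero (hu : SpansLayer 2 u) {b : A} (hb : b ∈ maximalIdeal A) :
    ∃ β : Fin 3 → A, b - ∑ i, β i * z i ∈ maximalIdeal A ∧
      ∀ a ∈ maximalIdeal A ^ 2, (b - ∑ i, β i * z i) * a = 0 := by
  -- The coefficient `β j` is read off from `b * u j = β j * s`.
  choose β hβ using fun j ↦ hs.exists_eq_mul_of_mem (mul_mem_pow_three hb (h.mem_u j))
  have hm : b - ∑ i, β i * z i ∈ maximalIdeal A :=
    sub_mem hb (Ideal.sum_mem _ fun i _ ↦ Ideal.mul_mem_left _ _ (h.mem_z i))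
  refine ⟨β, hm, fun a ha ↦ hs.mul_eq_zero_of_spansLayer hu hm (fun j ↦ ?_) ha⟩
  rw [sub_mul, h.sum_mul_u, hβ, sub_self]

/-- An element of `M ^ 2` killed by the elements `z i` lies in the socle. -/
theorem exists_eq_mul_of_z_mul_eq_zero (hu : SpansLayer 2 u) {y : A}
    (hy : y ∈ maximalIdeal A ^ 2) (hyz : ∀ i, z i * y = 0) : ∃ c, y = c * s := by
  refine hs.exists_eq_mul y fun b hb ↦ ?_
  obtain ⟨β, -, hβ⟩ := h.exists_sub_mul_eq_zero hs hu hb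
  have := hβ y hy
  rw [sub_mul, sub_eq_zero] at this
  rw [this, Finset.sum_mul]
  exact Finset.sum_eq_zero fun i _ ↦ by rw [mul_assoc, hyz, mul_zero]

/-- An element of `M` killed by all `z i * z j` is killed by `M ^ 2`. -/
theorem mul_eq_zero_of_mul_z_mul_z (hu : SpansLayer 2 u) {a : A} (ha : a ∈ maximalIdeal A)
    (haz : ∀ i j, a * z i * z j = 0) {b : A} (hb : b ∈ maximalIdeal A ^ 2) : a * b = 0 := by
  have key : ∀ b ∈ maximalIdeal A, ∀ j, a * b * z j = 0 := by
    intro b hb j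
    obtain ⟨β, -, hβ⟩ := h.exists_sub_mul_eq_zero hs hu hb
    have h1 := hβ (a * z j) (mul_mem_pow_two ha (h.mem_z j))
    rw [sub_mul, sub_eq_zero] at h1
    rw [mul_comm a b, mul_assoc, h1, Finset.sum_mul]
    exact Finset.sum_eq_zero fun i _ ↦ by
      rw [mul_assoc, ← mul_assoc (z i), mul_comm (z i) a, haz, mul_zero]
  rw [pow_two] at hb
  refine Submodule.mul_induction_on hb (fun b hb c hc ↦ ?_) fun b c hb hc ↦ ?_
  · obtain ⟨β, -, hβ⟩ := h.exists_sub_mul_eq_zero hs hu hc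
    have h1 := hβ (a * b) (mul_mem_pow_two ha hb)
    rw [sub_mul, sub_eq_zero] at h1
    rw [← mul_assoc, mul_comm (a * b) c, h1, Finset.sum_mul]
    exact Finset.sum_eq_zero fun i _ ↦ by rw [mul_assoc, mul_comm (z i), key b hb, mul_zero]
  · rw [mul_add, hb, hc, add_zero]

/-- Adding elements of `M ^ 2` to the `z i` changes the products `z i * z j` by arbitrary symmetric
multiples of the socle generator. -/
theorem exists_correction (b : Fin 3 → Fin 3 → A) :
    ∃ x : Fin 3 → A, IsDualSystem s x u ∧
      (∀ i j, x i * x j = z i * z j + (b i j + b j i) * s) ∧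
      ∀ i j l, x i * x j * x l = z i * z j * z l := by
  -- The new elements are `z i + ∑ l, b i l * u l`. Products of two corrections lie in `M ^ 4 = 0`,
  -- while `z j` pairs with the correction of `z i` to give `b i j * s`.
  have hq (i : Fin 3) : ∑ l, b i l * u l ∈ maximalIdeal A ^ 2 :=
    Ideal.sum_mem _ fun l _ ↦ Ideal.mul_mem_left _ _ (h.mem_u l)
  have hqq (i j : Fin 3) : (∑ l, b i l * u l) * ∑ l, b j l * u l = 0 :=
    hs.mul_eq_zero_of_mem_pow 2 2 le_rfl (hq i) (hq j)
  have hxx (i j : Fin 3) : (z i + ∑ l, b i l * u l) * (z j + ∑ l, b j l * u l) =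
      z i * z j + (b i j + b j i) * s := by
    rw [mul_add, add_mul, add_mul, hqq, h.z_mul_sum, mul_comm (∑ l, b i l * u l) (z j),
      h.z_mul_sum]
    ring
  refine ⟨fun i ↦ z i + ∑ l, b i l * u l, ⟨fun i ↦ add_mem (h.mem_z i)
    (Ideal.pow_le_self two_ne_zero (hq i)), h.mem_u, fun i j ↦ ?_⟩, hxx, fun i j l ↦ ?_⟩
  · rw [add_mul, hs.mul_eq_zero_of_mem_pow 2 2 le_rfl (hq i) (h.mem_u j), add_zero, h.mul_eq]
  · rw [hxx, add_mul, mul_add (z i * z j), mul_assoc _ s, mul_comm s,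
      hs.mul_eq_zero (add_mem (h.mem_z l) (Ideal.pow_le_self two_ne_zero (hq l))), mul_zero,
      hs.mul_eq_zero_of_mem_pow 2 2 le_rfl (mul_mem_pow_two (h.mem_z i) (h.mem_z j)) (hq l),
      add_zero, add_zero]

/-- Linear change of coordinates in a dual system. -/
theorem exists_change {P : Fin 3 → Fin 3 → ResidueField A}
    (hP : LinearIndependent (ResidueField A) P) (p : Fin 3 → Fin 3 → A)
    (hp : ∀ i j, residue A (p i j) = P i j) :
    ∃ u', IsDualSystem s (fun i ↦ ∑ j, p i j * z j) u' := by
  -- The `u` must change by the inverse matrix. It is lifted entrywise, which suffices because only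
  -- residues matter in front of `s`.
  have hunit : IsUnit (Matrix.of P) := Matrix.linearIndependent_rows_iff_isUnit.mp hP
  obtain ⟨Q, hQ⟩ := hunit.exists_right_inv
  choose q hq using fun i j ↦ residue_surjective (Q i j)
  refine ⟨fun j ↦ ∑ l, q l j * u l, fun i ↦ Ideal.sum_mem _ fun j _ ↦
    Ideal.mul_mem_left _ _ (h.mem_z j), fun i ↦ Ideal.sum_mem _ fun j _ ↦
    Ideal.mul_mem_left _ _ (h.mem_u j), fun i j ↦ ?_⟩
  have h1 : (∑ l, p i l * z l) * ∑ l, q l j * u l = (∑ l, p i l * q l j) * s := by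
    rw [Finset.sum_mul, Finset.sum_mul]
    refine Finset.sum_congr rfl fun l _ ↦ ?_
    rw [mul_assoc, h.z_mul_sum, mul_assoc]
  have h2 : residue A (∑ l, p i l * q l j) = (1 : Matrix (Fin 3) (Fin 3) (ResidueField A)) i j := by
    rw [← hQ, Matrix.mul_apply, map_sum]
    exact Finset.sum_congr rfl fun l _ ↦ by rw [map_mul, hp, hq]; rfl
  rw [h1]
  split_ifs with hij
  · subst hij
    rw [Matrix.one_apply_eq, ← map_one (residue A), ← hs.mul_eq_mul_iff, one_mul] at h2
    exact h2
  · rwa [Matrix.one_apply_ne hij, residue_eq_zero_iff, ← hs.mul_eq_zero_iff] at h2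

end IsDualSystem

end SocleDegreeThree

/-! ### The cubic form of `A`, and the relations of the normal forms in `A`. -/

section SocleDegreeThree

open IsLocalRing

variable {A : Type u} [CommRing A] [IsLocalRing A]

/-- Elements `x 0, x 1, x 2` satisfying the relations of one of the six normal forms, where `s` is
the corresponding generator of the socle. -/
def SatisfiesNormalForm (x : Fin 3 → A) (s : A) : Prop :=
  (∃ α : A, x 0 * x 1 + x 2 ^ 2 = 0 ∧ x 0 * x 2 = 0 ∧ x 0 ^ 2 + x 1 ^ 2 - α * x 2 ^ 2 = 0 ∧
      s = x 0 ^ 3) ∨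
    (x 0 ^ 2 = 0 ∧ x 1 ^ 2 = 0 ∧ x 2 ^ 2 + 2 * x 0 * x 1 = 0 ∧ s = x 0 * x 1 * x 2) ∨
    (x 0 ^ 2 = 0 ∧ x 1 ^ 2 = 0 ∧ x 2 ^ 2 = 0 ∧ s = x 0 * x 1 * x 2) ∨
    (x 1 ^ 3 - x 0 ^ 3 = 0 ∧ x 2 ^ 3 - x 0 ^ 3 = 0 ∧ x 0 * x 1 = 0 ∧ x 0 * x 2 = 0 ∧
      x 1 * x 2 = 0 ∧ s = x 0 ^ 3) ∨
    (x 0 ^ 2 = 0 ∧ x 0 * x 1 = 0 ∧ x 1 * x 2 = 0 ∧ x 1 ^ 3 - x 2 ^ 3 = 0 ∧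
      x 0 * x 2 ^ 2 - x 2 ^ 3 = 0 ∧ s = x 2 ^ 3) ∨
    (x 0 ^ 2 = 0 ∧ x 0 * x 1 = 0 ∧ 2 * x 0 * x 2 + x 1 ^ 2 = 0 ∧ x 2 ^ 3 = 0 ∧
      x 1 * x 2 ^ 2 = 0 ∧ s = x 0 * x 2 ^ 2)

namespace IsDualSystem

variable {s : A} {z u : Fin 3 → A} (hs : IsSocleGenerator A s) (h : IsDualSystem s z u)

include hs h in
/-- After a linear change of coordinates, the cubic form given by the multiplication
`M / (0 : M ^ 2) → M ^ 3` is in normal form. -/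
theorem exists_isCubicNormalForm [IsAlgClosed (ResidueField A)] (h2 : (2 : ResidueField A) ≠ 0)
    (h3 : (3 : ResidueField A) ≠ 0) (hu : SpansLayer 2 u) :
    ∃ (s' : A) (z' u' : Fin 3 → A), IsSocleGenerator A s' ∧ IsDualSystem s' z' u' ∧
      IsCubicNormalForm (fun x y w : A ↦ x * y * w) (z' 0) (z' 1) (z' 2) s' := by
  -- The residues of the `t i j l` are the coefficients of the cubic. They are symmetric although
  -- the chosen lifts need not be.
  choose t ht using fun i j l ↦
    hs.exists_eq_mul_of_mem (mul_mul_mem_pow_three (h.mem_z i) (h.mem_z j) (h.mem_z l))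
  have hmul (p q r : Fin 3 → A) : (∑ i, p i * z i) * (∑ j, q j * z j) * ∑ l, r l * z l =
      (∑ i, ∑ j, ∑ l, p i * q j * r l * t i j l) * s := by
    rw [Finset.sum_mul_sum, Finset.sum_mul, Finset.sum_mul]
    refine Finset.sum_congr rfl fun i _ ↦ ?_
    rw [Finset.sum_mul, Finset.sum_mul]
    refine Finset.sum_congr rfl fun j _ ↦ ?_
    rw [Finset.mul_sum, Finset.sum_mul]
    refine Finset.sum_congr rfl fun l _ ↦ ?_
    rw [mul_assoc _ (t i j l), ← ht]
    ring
  have ht₁ (i j l : Fin 3) : residue A (t i j l) = residue A (t j i l) := by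
    rw [← hs.mul_eq_mul_iff, ← ht, ← ht, mul_comm (z i)]
  have ht₂ (i j l : Fin 3) : residue A (t i j l) = residue A (t i l j) := by
    rw [← hs.mul_eq_mul_iff, ← ht, ← ht, mul_right_comm]
  let T : (Fin 3 → ResidueField A) → (Fin 3 → ResidueField A) → (Fin 3 → ResidueField A) →
      ResidueField A := fun x y w ↦
    ∑ i, ∑ j, ∑ l, x i * y j * w l * residue A (t i j l)
  have hT : IsSymmTrilinear T :=
    { add_left := fun x x' y w ↦ by simp only [T, Pi.add_apply, add_mul, Finset.sum_add_distrib]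
      smul_left := fun a x y w ↦ by
        simp only [T, Pi.smul_apply, smul_eq_mul, mul_assoc, Finset.mul_sum]
      swap_left := fun x y w ↦ by
        simp only [T]
        rw [Finset.sum_comm]
        refine Finset.sum_congr rfl fun i _ ↦ Finset.sum_congr rfl fun j _ ↦
          Finset.sum_congr rfl fun l _ ↦ ?_
        rw [ht₁, mul_comm (x j)]
      swap_right := fun x y w ↦ by
        simp only [T]
        refine Finset.sum_congr rfl fun i _ ↦ ?_
        rw [Finset.sum_comm]
        refine Finset.sum_congr rfl fun j _ ↦ Finset.sum_congr rfl fun l _ ↦ ?_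
        rw [ht₂]
        ring }
  have hres (p q r : Fin 3 → A) : residue A (∑ i, ∑ j, ∑ l, p i * q j * r l * t i j l) =
      T (fun i ↦ residue A (p i)) (fun i ↦ residue A (q i)) fun i ↦ residue A (r i) := by
    simp only [T, map_sum, map_mul]
  -- Nondegeneracy: an element of `M` killed by all `z i * z j` is killed by `M ^ 2`, in particular
  -- by the `u i`, which detect its coordinates.
  have hnd : ∀ v, (∀ y w, T v y w = 0) → v = 0 := by
    intro v hv
    choose p hp using fun i ↦ residue_surjective (v i)
    have hp' : (fun i ↦ residue A (p i)) = v := funext hp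
    have hz (i : Fin 3) : z i = ∑ j, Pi.single (M := fun _ ↦ A) i 1 j * z j := by
      rw [Finset.sum_eq_single i] <;> simp +contextual
    have ha : ∑ i, p i * z i ∈ maximalIdeal A :=
      Ideal.sum_mem _ fun i _ ↦ Ideal.mul_mem_left _ _ (h.mem_z i)
    have hzero : ∀ i j, (∑ i, p i * z i) * z i * z j = 0 := by
      intro i j
      rw [hz i, hz j, hmul, hs.mul_eq_zero_iff, ← residue_eq_zero_iff, hres, hp']
      exact hv _ _
    ext i
    have := h.mul_eq_zero_of_mul_z_mul_z hs hu ha hzero (h.mem_u i)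
    rw [h.sum_mul_u, hs.mul_eq_zero_iff, ← residue_eq_zero_iff, hp] at this
    exact this
  obtain ⟨e₁, e₂, e₃, c, hc, hn⟩ := hT.hasCubicNormalForm h2 h3 (by simp) hnd
  have hli := hT.linearIndependent_of_normalForm h2 hc hn
  obtain ⟨e, he⟩ : ∃ e : Fin 3 → Fin 3 → ResidueField A, e = ![e₁, e₂, e₃] := ⟨_, rfl⟩
  rw [← he] at hli
  choose p hp using fun i j ↦ residue_surjective (e i j)
  obtain ⟨c, rfl⟩ := residue_surjective c
  have hcu : IsUnit c := by
    rwa [← notMem_maximalIdeal, ← residue_eq_zero_iff]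
  obtain ⟨u', hu'⟩ := h.exists_change hs hli p hp
  have hpi (i : Fin 3) : (fun j ↦ residue A (p i j)) = e i := funext (hp i)
  have hval (i j l : Fin 3) (d : A) (hd : T (e i) (e j) (e l) = residue A d) :
      (∑ m, p i m * z m) * (∑ m, p j m * z m) * ∑ m, p l m * z m = d * s := by
    rw [hmul, hs.mul_eq_mul_iff, hres, hpi, hpi, hpi, hd]
  have transfer {t₁₁₁ t₁₁₂ t₁₁₃ t₁₂₂ t₁₂₃ t₁₃₃ t₂₂₂ t₂₂₃ t₂₃₃ t₃₃₃ : A}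
      (hv : CubicValues T e₁ e₂ e₃ (residue A t₁₁₁) (residue A t₁₁₂) (residue A t₁₁₃)
        (residue A t₁₂₂) (residue A t₁₂₃) (residue A t₁₃₃) (residue A t₂₂₂) (residue A t₂₂₃)
        (residue A t₂₃₃) (residue A t₃₃₃)) :
      CubicValues (fun x y w : A ↦ x * y * w) (∑ m, p 0 m * z m) (∑ m, p 1 m * z m)
        (∑ m, p 2 m * z m) (t₁₁₁ * s) (t₁₁₂ * s) (t₁₁₃ * s) (t₁₂₂ * s) (t₁₂₃ * s) (t₁₃₃ * s)
        (t₂₂₂ * s) (t₂₂₃ * s) (t₂₃₃ * s) (t₃₃₃ * s) := by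
    obtain ⟨h111, h112, h113, h122, h123, h133, h222, h223, h233, h333⟩ := hv
    subst he
    exact ⟨hval 0 0 0 _ h111, hval 0 0 1 _ h112, hval 0 0 2 _ h113, hval 0 1 1 _ h122,
      hval 0 1 2 _ h123, hval 0 2 2 _ h133, hval 1 1 1 _ h222, hval 1 1 2 _ h223,
      hval 1 2 2 _ h233, hval 2 2 2 _ h333⟩
  -- The scalar `c` of the normal form is absorbed into the socle generator. Duality then requires
  -- multiplying the `u` by `c` as well.
  refine ⟨c * s, fun i ↦ ∑ j, p i j * z j, fun i ↦ c * u' i, hs.unit_mul hcu,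
    ⟨hu'.mem_z, fun i ↦ Ideal.mul_mem_left _ _ (hu'.mem_u i), fun i j ↦ ?_⟩, ?_⟩
  · rw [mul_left_comm, hu'.mul_eq]
    split_ifs <;> simp
  · have h0 : (0 : ResidueField A) = residue A 0 := (map_zero _).symm
    have hneg : -residue A c = residue A (-c) := (map_neg _ _).symm
    have htwo : -(2 * residue A c) = residue A (-(2 * c)) := by
      rw [map_neg, map_mul, map_ofNat]
    rcases hn with ⟨α, hv⟩ | hv | hv | hv | hv | hv
    · obtain ⟨α, rfl⟩ := residue_surjective α
      rw [h0, hneg, ← map_mul] at hv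
      exact Or.inl ⟨α, by simpa only [zero_mul, neg_mul, mul_assoc] using transfer hv⟩
    · rw [h0, htwo] at hv
      exact Or.inr <| Or.inl <| by simpa only [zero_mul, neg_mul, mul_assoc] using transfer hv
    · rw [h0] at hv
      exact Or.inr <| Or.inr <| Or.inl <| by
        simpa only [zero_mul, neg_mul, mul_assoc] using transfer hv
    · rw [h0] at hv
      exact Or.inr <| Or.inr <| Or.inr <| Or.inl <| by
        simpa only [zero_mul, neg_mul, mul_assoc] using transfer hv
    · rw [h0] at hv
      exact Or.inr <| Or.inr <| Or.inr <| Or.inr <| Or.inl <| by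
        simpa only [zero_mul, neg_mul, mul_assoc] using transfer hv
    · rw [h0, htwo] at hv
      exact Or.inr <| Or.inr <| Or.inr <| Or.inr <| Or.inr <| by
        simpa only [zero_mul, neg_mul, mul_assoc] using transfer hv

-- An upper triangular matrix `b` in `exists_correction` prescribes the six corrections
-- independently. The diagonal entries enter twice there, hence the factor `η = 1 / 2`.
include hs h in
theorem exists_triangular_correction (h2 : IsUnit (2 : A)) (g₀₀ g₀₁ g₀₂ g₁₁ g₁₂ g₂₂ : A) :
    ∃ x : Fin 3 → A, IsDualSystem s x u ∧
      (x 0 * x 0 = z 0 * z 0 - g₀₀ * s ∧ x 0 * x 1 = z 0 * z 1 - g₀₁ * s ∧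
        x 0 * x 2 = z 0 * z 2 - g₀₂ * s ∧ x 1 * x 1 = z 1 * z 1 - g₁₁ * s ∧
        x 1 * x 2 = z 1 * z 2 - g₁₂ * s ∧ x 2 * x 2 = z 2 * z 2 - g₂₂ * s) ∧
      ∀ i j l, x i * x j * x l = z i * z j * z l := by
  obtain ⟨η, hη⟩ := h2.exists_right_inv
  obtain ⟨x, hx, hxx, hxxx⟩ := h.exists_correction hs
    ![![-(η * g₀₀), -g₀₁, -g₀₂], ![0, -(η * g₁₁), -g₁₂], ![0, 0, -(η * g₂₂)]]
  refine ⟨x, hx, ⟨?_, ?_, ?_, ?_, ?_, ?_⟩, hxxx⟩ <;> rw [hxx] <;> simp only [Matrix.cons_val]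
  · linear_combination -g₀₀ * s * hη
  · ring
  · ring
  · linear_combination -g₁₁ * s * hη
  · ring
  · linear_combination -g₂₂ * s * hη

include hs h in
/-- After a change of coordinates, the relations of one of the six normal forms hold. -/
theorem exists_satisfiesNormalForm (h2 : IsUnit (2 : A)) (hu : SpansLayer 2 u)
    (hn : IsCubicNormalForm (fun x y w : A ↦ x * y * w) (z 0) (z 1) (z 2) s) :
    ∃ x : Fin 3 → A, IsDualSystem s x u ∧ SatisfiesNormalForm x s := by
  have hzz (i j : Fin 3) : z i * z j ∈ maximalIdeal A ^ 2 := mul_mem_pow_two (h.mem_z i) (h.mem_z j)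
  -- A quadric in the `z i` that the cubic annihilates lies in the socle, so it is a relation up to
  -- a multiple of `s`.
  have hq {y : A} (hy : y ∈ maximalIdeal A ^ 2) (h0 : z 0 * y = 0) (h1 : z 1 * y = 0)
      (h2 : z 2 * y = 0) : ∃ c, y = c * s :=
    h.exists_eq_mul_of_z_mul_eq_zero hs hu hy fun i ↦ by fin_cases i <;> assumption
  rcases hn with ⟨α, hv⟩ | hv | hv | hv | hv | hv <;>
    obtain ⟨h000, h001, h002, h011, h012, h022, h111, h112, h122, h222⟩ := hv <;>
    dsimp only at h000 h001 h002 h011 h012 h022 h111 h112 h122 h222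
  · obtain ⟨c₁, hc₁⟩ := hq (add_mem (hzz 0 1) (hzz 2 2)) (by linear_combination h001 + h022)
      (by linear_combination h011 + h122) (by linear_combination h012 + h222)
    obtain ⟨c₂, hc₂⟩ := hq (hzz 0 2) (by linear_combination h002) (by linear_combination h012)
      (by linear_combination h022)
    obtain ⟨c₃, hc₃⟩ := hq (sub_mem (add_mem (hzz 0 0) (hzz 1 1))
      (Ideal.mul_mem_left _ α (hzz 2 2))) (by linear_combination h000 + h011 - α * h022)
      (by linear_combination h001 + h111 - α * h122) (by linear_combination h002 + h112 - α * h222)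
    -- Each of the three quadrics contains a product that occurs in neither of the others, and its
    -- error is absorbed there. The same choice works in all six cases.
    obtain ⟨x, hx, ⟨x00, x01, x02, x11, x12, x22⟩, hxxx⟩ :=
      h.exists_triangular_correction hs h2 c₃ c₁ c₂ 0 0 0
    refine ⟨x, hx, Or.inl ⟨α, ?_, ?_, ?_, ?_⟩⟩
    · linear_combination x01 + x22 + hc₁
    · linear_combination x02 + hc₂
    · linear_combination x00 + x11 - α * x22 + hc₃
    · linear_combination -hxxx 0 0 0 - h000
  · obtain ⟨c₁, hc₁⟩ := hq (hzz 0 0) (by linear_combination h000) (by linear_combination h001)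
      (by linear_combination h002)
    obtain ⟨c₂, hc₂⟩ := hq (hzz 1 1) (by linear_combination h011) (by linear_combination h111)
      (by linear_combination h112)
    obtain ⟨c₃, hc₃⟩ := hq (add_mem (hzz 2 2) (Ideal.mul_mem_left _ 2 (hzz 0 1)))
      (by linear_combination h022 + 2 * h001) (by linear_combination h122 + 2 * h011)
      (by linear_combination h222 + 2 * h012)
    obtain ⟨x, hx, ⟨x00, x01, x02, x11, x12, x22⟩, hxxx⟩ :=
      h.exists_triangular_correction hs h2 c₁ 0 0 c₂ 0 c₃
    refine ⟨x, hx, Or.inr <| Or.inl ⟨?_, ?_, ?_, ?_⟩⟩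
    · linear_combination x00 + hc₁
    · linear_combination x11 + hc₂
    · linear_combination x22 + 2 * x01 + hc₃
    · linear_combination -hxxx 0 1 2 - h012
  · obtain ⟨c₁, hc₁⟩ := hq (hzz 0 0) (by linear_combination h000) (by linear_combination h001)
      (by linear_combination h002)
    obtain ⟨c₂, hc₂⟩ := hq (hzz 1 1) (by linear_combination h011) (by linear_combination h111)
      (by linear_combination h112)
    obtain ⟨c₃, hc₃⟩ := hq (hzz 2 2) (by linear_combination h022) (by linear_combination h122)
      (by linear_combination h222)
    obtain ⟨x, hx, ⟨x00, x01, x02, x11, x12, x22⟩, hxxx⟩ :=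
      h.exists_triangular_correction hs h2 c₁ 0 0 c₂ 0 c₃
    refine ⟨x, hx, Or.inr <| Or.inr <| Or.inl ⟨?_, ?_, ?_, ?_⟩⟩
    · linear_combination x00 + hc₁
    · linear_combination x11 + hc₂
    · linear_combination x22 + hc₃
    · linear_combination -hxxx 0 1 2 - h012
  · obtain ⟨c₁, hc₁⟩ := hq (hzz 0 1) (by linear_combination h001) (by linear_combination h011)
      (by linear_combination h012)
    obtain ⟨c₂, hc₂⟩ := hq (hzz 0 2) (by linear_combination h002) (by linear_combination h012)
      (by linear_combination h022)
    obtain ⟨c₃, hc₃⟩ := hq (hzz 1 2) (by linear_combination h012) (by linear_combination h112)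
      (by linear_combination h122)
    obtain ⟨x, hx, ⟨x00, x01, x02, x11, x12, x22⟩, hxxx⟩ :=
      h.exists_triangular_correction hs h2 0 c₁ c₂ 0 c₃ 0
    refine ⟨x, hx, Or.inr <| Or.inr <| Or.inr <| Or.inl ⟨?_, ?_, ?_, ?_, ?_, ?_⟩⟩
    · linear_combination hxxx 1 1 1 + h111 - hxxx 0 0 0 - h000
    · linear_combination hxxx 2 2 2 + h222 - hxxx 0 0 0 - h000
    · linear_combination x01 + hc₁
    · linear_combination x02 + hc₂
    · linear_combination x12 + hc₃
    · linear_combination -hxxx 0 0 0 - h000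
  · obtain ⟨c₁, hc₁⟩ := hq (hzz 0 0) (by linear_combination h000) (by linear_combination h001)
      (by linear_combination h002)
    obtain ⟨c₂, hc₂⟩ := hq (hzz 0 1) (by linear_combination h001) (by linear_combination h011)
      (by linear_combination h012)
    obtain ⟨c₃, hc₃⟩ := hq (hzz 1 2) (by linear_combination h012) (by linear_combination h112)
      (by linear_combination h122)
    obtain ⟨x, hx, ⟨x00, x01, x02, x11, x12, x22⟩, hxxx⟩ :=
      h.exists_triangular_correction hs h2 c₁ c₂ 0 0 c₃ 0
    refine ⟨x, hx, Or.inr <| Or.inr <| Or.inr <| Or.inr <| Or.inl ⟨?_, ?_, ?_, ?_, ?_, ?_⟩⟩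
    · linear_combination x00 + hc₁
    · linear_combination x01 + hc₂
    · linear_combination x12 + hc₃
    · linear_combination hxxx 1 1 1 + h111 - hxxx 2 2 2 - h222
    · linear_combination hxxx 0 2 2 + h022 - hxxx 2 2 2 - h222
    · linear_combination -hxxx 2 2 2 - h222
  · obtain ⟨c₁, hc₁⟩ := hq (hzz 0 0) (by linear_combination h000) (by linear_combination h001)
      (by linear_combination h002)
    obtain ⟨c₂, hc₂⟩ := hq (hzz 0 1) (by linear_combination h001) (by linear_combination h011)
      (by linear_combination h012)
    obtain ⟨c₃, hc₃⟩ := hq (add_mem (Ideal.mul_mem_left _ 2 (hzz 0 2)) (hzz 1 1))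
      (by linear_combination 2 * h002 + h011) (by linear_combination 2 * h012 + h111)
      (by linear_combination 2 * h022 + h112)
    obtain ⟨x, hx, ⟨x00, x01, x02, x11, x12, x22⟩, hxxx⟩ :=
      h.exists_triangular_correction hs h2 c₁ c₂ 0 c₃ 0 0
    refine ⟨x, hx, Or.inr <| Or.inr <| Or.inr <| Or.inr <| Or.inr ⟨?_, ?_, ?_, ?_, ?_, ?_⟩⟩
    · linear_combination x00 + hc₁
    · linear_combination x01 + hc₂
    · linear_combination 2 * x02 + x11 + hc₃
    · linear_combination hxxx 2 2 2 + h222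
    · linear_combination hxxx 1 2 2 + h122
    · linear_combination -hxxx 0 2 2 - h022

end IsDualSystem

end SocleDegreeThree

/-! ### Orthonormal families in the annihilator of `M ^ 2`: the remaining generators. -/

section SocleDegreeThree

open IsLocalRing

variable {A : Type u} [CommRing A] [IsLocalRing A]

/-- Elements `y i` of the annihilator of `M ^ 2` that are orthogonal to the `z j` and orthonormal
with respect to the socle generator `s`. -/
structure IsOrthonormalFamily (s : A) (z : Fin 3 → A) {m : ℕ} (y : Fin m → A) : Prop where
  mem : ∀ i, y i ∈ maximalIdeal A
  z_mul : ∀ j i, z j * y i = 0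
  mul_pow_two : ∀ i, ∀ a ∈ maximalIdeal A ^ 2, y i * a = 0
  mul_eq : ∀ i j, y i * y j = if i = j then s else 0

namespace IsOrthonormalFamily

variable {s : A} {z u : Fin 3 → A} {m : ℕ} {y : Fin m → A} (h : IsOrthonormalFamily s z y)
include h

theorem mul_sum (c : Fin m → A) (i : Fin m) : y i * ∑ j, c j * y j = c i * s := by
  rw [Finset.mul_sum, Finset.sum_eq_single i]
  · rw [mul_left_comm, h.mul_eq, if_pos rfl]
  · intro j _ hij
    rw [mul_left_comm, h.mul_eq, if_neg hij.symm, mul_zero]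
  · simp

theorem z_mul_sum (c : Fin m → A) (i : Fin 3) : z i * ∑ j, c j * y j = 0 := by
  rw [Finset.mul_sum]
  exact Finset.sum_eq_zero fun j _ ↦ by rw [mul_left_comm, h.z_mul, mul_zero]

variable (hs : IsSocleGenerator A s)
include hs

/-- An orthonormal family can be enlarged by a nonisotropic vector orthogonal to it. -/
theorem exists_extension [IsAlgClosed (ResidueField A)] {r : A} (hr : r ∈ maximalIdeal A)
    (hzr : ∀ i, z i * r = 0) (hr2 : ∀ a ∈ maximalIdeal A ^ 2, r * a = 0) (hyr : ∀ i, y i * r = 0)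
    (hrr : r * r ≠ 0) : ∃ y' : Fin (m + 1) → A, IsOrthonormalFamily s z y' := by
  obtain ⟨ρ, hρ⟩ := hs.exists_eq_mul (r * r) fun a ha ↦ by
    rw [← mul_assoc, mul_comm, hr2 _ (mul_mem_pow_two ha hr)]
  have hρu : IsUnit ρ := by
    rw [← notMem_maximalIdeal, ← hs.mul_eq_zero_iff, ← hρ]
    exact hrr
  obtain ⟨σ, hσ⟩ := hρu.exists_right_inv
  -- With `r * r = ρ * s`, the vector is normalized by a square root of `1 / ρ`. A root in the
  -- residue field suffices, since `M * s = 0`.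
  obtain ⟨t, ht⟩ := IsAlgClosed.exists_pow_nat_eq (residue A σ) two_pos
  obtain ⟨t, rfl⟩ := residue_surjective t
  have hts : t * r * (t * r) = s := by
    have h1 : t * r * (t * r) = (t ^ 2 * ρ) * s := by rw [mul_assoc (t ^ 2), ← hρ]; ring
    rw [h1, ← one_mul s, ← mul_assoc, hs.mul_eq_mul_iff, mul_one, map_mul, map_pow, ht, ← map_mul,
      mul_comm, hσ]
  refine ⟨Fin.cons (t * r) y, ⟨fun i ↦ ?_, fun j i ↦ ?_, fun i a ha ↦ ?_, fun i j ↦ ?_⟩⟩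
  · refine Fin.cases ?_ (fun i ↦ ?_) i
    · exact Ideal.mul_mem_left _ _ hr
    · exact h.mem i
  · refine Fin.cases ?_ (fun i ↦ ?_) i
    · rw [Fin.cons_zero, mul_left_comm, hzr, mul_zero]
    · exact h.z_mul j i
  · refine Fin.cases ?_ (fun i ↦ ?_) i
    · rw [Fin.cons_zero, mul_assoc, hr2 a ha, mul_zero]
    · exact h.mul_pow_two i a ha
  · refine Fin.cases ?_ (fun i ↦ ?_) i <;> refine Fin.cases ?_ (fun j ↦ ?_) j
    · simp [hts]
    · rw [Fin.cons_zero, Fin.cons_succ, mul_assoc, mul_comm r, hyr, mul_zero,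
        if_neg (Fin.succ_ne_zero j).symm]
    · rw [Fin.cons_zero, Fin.cons_succ, mul_left_comm, hyr, mul_zero, if_neg (Fin.succ_ne_zero i)]
    · simp [h.mul_eq, Fin.succ_inj]

variable (hz : IsDualSystem s z u)
include hz

/-- Multiplication by `u i` kills `M ^ 2` and the `y j` and detects the coefficient of `z i`.
Multiplication by `y i` kills `M ^ 2` and the `z j` and detects the coefficient of `y i`. -/
theorem indepLayer : IndepLayer 1 (Fin.append z y) := by
  intro c hc
  rw [Fin.sum_univ_add] at hc
  simp only [Fin.append_left, Fin.append_right] at hc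
  refine fun i ↦ Fin.addCases (fun i ↦ ?_) (fun i ↦ ?_) i
  · have h1 := hs.mul_eq_zero_of_mem_pow (1 + 1) 2 le_rfl hc (hz.mem_u i)
    have h2 : (∑ j : Fin m, c (Fin.natAdd 3 j) * y j) * u i = 0 := by
      rw [Finset.sum_mul]
      exact Finset.sum_eq_zero fun j _ ↦ by
        rw [mul_assoc, h.mul_pow_two j _ (hz.mem_u i), mul_zero]
    rwa [add_mul, h2, add_zero, hz.sum_mul_u (fun j ↦ c (Fin.castAdd m j)),
      hs.mul_eq_zero_iff] at h1
  · have h1 := h.mul_pow_two i _ hc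
    have h2 : y i * ∑ j : Fin 3, c (Fin.castAdd m j) * z j = 0 := by
      rw [Finset.mul_sum]
      exact Finset.sum_eq_zero fun j _ ↦ by
        rw [mul_left_comm, mul_comm (y i), h.z_mul, mul_zero]
    rwa [mul_add, h2, zero_add, h.mul_sum (fun j ↦ c (Fin.natAdd 3 j)),
      hs.mul_eq_zero_iff] at h1

/-- Bounds the length of orthonormal families, so that a maximal one exists. -/
theorem add_le [IsNoetherianRing A] : 3 + m ≤ localHilbertFunction A 1 := by
  refine le_localHilbertFunction _ (fun i ↦ ?_) (h.indepLayer hs hz)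
  rw [pow_one]
  refine Fin.addCases (fun i ↦ ?_) (fun i ↦ ?_) i
  · rw [Fin.append_left]; exact hz.mem_z i
  · rw [Fin.append_right]; exact h.mem i

/-- Gram–Schmidt: subtract a combination of the `z i` to reach the annihilator of `M ^ 2`, then a
combination of the `u i` to become orthogonal to the `z i`, and a combination of the `y i` to become
orthogonal to these. The second correction is invisible to the `y i`, which kill `M ^ 2`. -/
theorem exists_decomposition (hu : SpansLayer 2 u) {b : A} (hb : b ∈ maximalIdeal A) :
    ∃ (β : Fin 3 → A) (μ : Fin m → A) (q r : A), b = ∑ i, β i * z i + ∑ i, μ i * y i + q + r ∧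
      q ∈ maximalIdeal A ^ 2 ∧ r ∈ maximalIdeal A ∧ (∀ i, z i * r = 0) ∧
      (∀ a ∈ maximalIdeal A ^ 2, r * a = 0) ∧ ∀ i, y i * r = 0 := by
  obtain ⟨β, hm, hβ⟩ := hz.exists_sub_mul_eq_zero hs hu hb
  obtain ⟨n, hn⟩ : ∃ n, n = b - ∑ i, β i * z i := ⟨_, rfl⟩
  rw [← hn] at hm hβ
  have hzn (i : Fin 3) : ∃ c, z i * n = c * s := hs.exists_eq_mul _ fun a ha ↦ by
    rw [← mul_assoc, mul_comm, hβ _ (mul_mem_pow_two ha (hz.mem_z i))]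
  choose ν hν using hzn
  have hq : ∑ i, ν i * u i ∈ maximalIdeal A ^ 2 :=
    Ideal.sum_mem _ fun i _ ↦ Ideal.mul_mem_left _ _ (hz.mem_u i)
  have hyn (i : Fin m) : ∃ c, y i * n = c * s := hs.exists_eq_mul _ fun a ha ↦ by
    rw [← mul_assoc, mul_comm, hβ _ (mul_mem_pow_two ha (h.mem i))]
  choose μ hμ using hyn
  have hr : n - ∑ i, ν i * u i - ∑ i, μ i * y i ∈ maximalIdeal A :=
    sub_mem (sub_mem hm (Ideal.pow_le_self two_ne_zero hq))
      (Ideal.sum_mem _ fun i _ ↦ Ideal.mul_mem_left _ _ (h.mem i))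
  refine ⟨β, μ, ∑ i, ν i * u i, n - ∑ i, ν i * u i - ∑ i, μ i * y i, by rw [hn]; ring, hq, hr,
    fun i ↦ ?_, fun a ha ↦ ?_, fun i ↦ ?_⟩
  · rw [mul_sub, mul_sub, hν, hz.z_mul_sum, sub_self, h.z_mul_sum, sub_zero]
  · rw [sub_mul, sub_mul, hβ a ha, hs.mul_eq_zero_of_mem_pow 2 2 le_rfl hq ha, Finset.sum_mul,
      sub_zero, zero_sub, neg_eq_zero]
    exact Finset.sum_eq_zero fun i _ ↦ by rw [mul_assoc, h.mul_pow_two i a ha, mul_zero]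
  · rw [mul_sub, mul_sub, hμ, h.mul_pow_two i _ hq, h.mul_sum, sub_zero, sub_self]

/-- A maximal orthonormal family generates `M` together with the `z i`. -/
theorem exists_sub_mem_pow_two [IsAlgClosed (ResidueField A)] (h2 : IsUnit (2 : A))
    (hu : SpansLayer 2 u)
    (hmax : ¬ ∃ y' : Fin (m + 1) → A, IsOrthonormalFamily s z y') {b : A}
    (hb : b ∈ maximalIdeal A) :
    ∃ (β : Fin 3 → A) (μ : Fin m → A), b - (∑ i, β i * z i + ∑ i, μ i * y i) ∈
      maximalIdeal A ^ 2 := by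
  obtain ⟨β, μ, q, r, rfl, hq, hr, hzr, hr2, hyr⟩ := h.exists_decomposition hs hz hu hb
  -- By maximality, every element orthogonal to the family is isotropic. Polarization with 2
  -- invertible then makes all products of such elements vanish, so `r` lies in the socle, hence in
  -- `M ^ 2`.
  have hsq {a : A} (ha : a ∈ maximalIdeal A) (hza : ∀ i, z i * a = 0)
      (ha2 : ∀ c ∈ maximalIdeal A ^ 2, a * c = 0) (hya : ∀ i, y i * a = 0) : a * a = 0 := by
    by_contra hne
    exact hmax (h.exists_extension hs ha hza ha2 hya hne)
  have hsoc : ∀ a ∈ maximalIdeal A, a * r = 0 := by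
    intro a ha
    obtain ⟨β', μ', q', r', rfl, hq', hr', hzr', hr2', hyr'⟩ := h.exists_decomposition hs hz hu ha
    have h1 := hsq (add_mem hr hr') (fun i ↦ by rw [mul_add, hzr, hzr', add_zero])
      (fun c hc ↦ by rw [add_mul, hr2 c hc, hr2' c hc, add_zero])
      fun i ↦ by rw [mul_add, hyr, hyr', add_zero]
    have h3 : 2 * (r' * r) = 0 := by
      linear_combination h1 - hsq hr hzr hr2 hyr - hsq hr' hzr' hr2' hyr'
    rw [h2.mul_right_eq_zero] at h3
    rw [add_mul, add_mul, add_mul, h3, mul_comm q', hr2 q' hq', Finset.sum_mul, Finset.sum_mul,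
      Finset.sum_eq_zero fun i _ ↦ by rw [mul_assoc, hzr, mul_zero],
      Finset.sum_eq_zero fun i _ ↦ by rw [mul_assoc, hyr, mul_zero]]
    simp
  obtain ⟨c, rfl⟩ := hs.exists_eq_mul r hsoc
  refine ⟨β, μ, ?_⟩
  rw [add_assoc _ q, add_sub_cancel_left]
  exact add_mem hq (Ideal.mul_mem_left _ _ (Ideal.pow_le_pow_right (by norm_num) hs.mem))

end IsOrthonormalFamily

/-- A maximal orthonormal family together with the `z i` is a basis of `M / M ^ 2`. The resulting
count `H(1) = 3 + m` gives the bound `n ≥ 3`. -/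
theorem IsDualSystem.exists_isOrthonormalFamily [IsNoetherianRing A] [IsAlgClosed (ResidueField A)]
    {s : A} {z u : Fin 3 → A} (hs : IsSocleGenerator A s) (hz : IsDualSystem s z u)
    (h2 : IsUnit (2 : A)) (hu : SpansLayer 2 u) :
    ∃ (m : ℕ) (y : Fin m → A), IsOrthonormalFamily s z y ∧ localHilbertFunction A 1 = 3 + m ∧
      ∀ b ∈ maximalIdeal A, ∃ (β : Fin 3 → A) (μ : Fin m → A),
        b - (∑ i, β i * z i + ∑ i, μ i * y i) ∈ maximalIdeal A ^ 2 := by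
  obtain ⟨m, ⟨y, hy⟩, hmax⟩ : ∃ m, (∃ y : Fin m → A, IsOrthonormalFamily s z y) ∧
      ¬ ∃ y : Fin (m + 1) → A, IsOrthonormalFamily s z y := by
    by_contra! hcon
    have hall (m : ℕ) : ∃ y : Fin m → A, IsOrthonormalFamily s z y := by
      induction m with
      | zero => exact ⟨Fin.elim0, fun i ↦ i.elim0, fun _ i ↦ i.elim0, fun i ↦ i.elim0,
          fun i ↦ i.elim0⟩
      | succ m ih =>
        obtain ⟨y, hy⟩ := ih
        exact hcon m ⟨y, hy⟩
    obtain ⟨y, hy⟩ := hall (localHilbertFunction A 1)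
    have := hy.add_le hs hz
    omega
  have hspan := fun b hb ↦ hy.exists_sub_mem_pow_two hs hz h2 hu hmax (b := b) hb
  refine ⟨m, y, hy, le_antisymm ?_ (hy.add_le hs hz), hspan⟩
  refine localHilbertFunction_le (t := 1) (Fin.append z y) (fun i ↦ ?_) fun b hb ↦ ?_
  · rw [pow_one]
    refine Fin.addCases (fun i ↦ ?_) (fun i ↦ ?_) i
    · rw [Fin.append_left]; exact hz.mem_z i
    · rw [Fin.append_right]; exact hy.mem i
  · rw [pow_one] at hb
    obtain ⟨β, μ, h⟩ := hspan b hb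
    refine ⟨Fin.append β μ, ?_⟩
    rw [Fin.sum_univ_add]
    simpa only [Fin.append_left, Fin.append_right] using h

end SocleDegreeThree

/-! ### Consequences of the relations of the normal forms in an arbitrary commutative ring. -/

section QuadricBasis

variable {B : Type*} [CommRing B]

/-- The quadrics `w₀, w₁, w₂` span the products of the elements `a, b, c`, the multiples of `σ`
contain the products of these quadrics with `a, b, c`, and `a, b, c` kill `σ`. -/
structure IsQuadricBasis (a b c w₀ w₁ w₂ σ : B) : Prop where
  aa : ∃ r₀ r₁ r₂, a * a = r₀ * w₀ + r₁ * w₁ + r₂ * w₂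
  ab : ∃ r₀ r₁ r₂, a * b = r₀ * w₀ + r₁ * w₁ + r₂ * w₂
  ac : ∃ r₀ r₁ r₂, a * c = r₀ * w₀ + r₁ * w₁ + r₂ * w₂
  bb : ∃ r₀ r₁ r₂, b * b = r₀ * w₀ + r₁ * w₁ + r₂ * w₂
  bc : ∃ r₀ r₁ r₂, b * c = r₀ * w₀ + r₁ * w₁ + r₂ * w₂
  cc : ∃ r₀ r₁ r₂, c * c = r₀ * w₀ + r₁ * w₁ + r₂ * w₂
  a₀ : ∃ r, a * w₀ = r * σ
  a₁ : ∃ r, a * w₁ = r * σ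
  a₂ : ∃ r, a * w₂ = r * σ
  b₀ : ∃ r, b * w₀ = r * σ
  b₁ : ∃ r, b * w₁ = r * σ
  b₂ : ∃ r, b * w₂ = r * σ
  c₀ : ∃ r, c * w₀ = r * σ
  c₁ : ∃ r, c * w₁ = r * σ
  c₂ : ∃ r, c * w₂ = r * σ
  aσ : a * σ = 0
  bσ : b * σ = 0
  cσ : c * σ = 0

variable {a b c : B}

/-- The relations give `b c ^ 2 = b (c c) = a ^ 3`, `a b ^ 2 = -a ^ 3` and `b ^ 3 = α a ^ 3`.
Evaluating `a b c ^ 2` by this and by `a c = 0` yields `a ^ 4 = 0`. -/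
theorem isQuadricBasis_nodal_or_smooth {α : B} (r₁ : a * b + c ^ 2 = 0) (r₂ : a * c = 0)
    (r₃ : a ^ 2 + b ^ 2 - α * c ^ 2 = 0) :
    IsQuadricBasis a b c (c * c) (b * c) (b * b) (a ^ 3) where
  aa := ⟨α, 0, -1, by linear_combination r₃⟩
  ab := ⟨-1, 0, 0, by linear_combination r₁⟩
  ac := ⟨0, 0, 0, by linear_combination r₂⟩
  bb := ⟨0, 0, 1, by ring⟩
  bc := ⟨0, 1, 0, by ring⟩
  cc := ⟨1, 0, 0, by ring⟩
  a₀ := ⟨0, by linear_combination c * r₂⟩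
  a₁ := ⟨0, by linear_combination b * r₂⟩
  a₂ := ⟨-1, by linear_combination a * r₃ + α * c * r₂⟩
  b₀ := ⟨1, by linear_combination b * r₁ - a * r₃ - α * c * r₂⟩
  b₁ := ⟨0, by linear_combination c * r₃ - a * r₂ + α * (c * r₁ - b * r₂)⟩
  b₂ := ⟨α, by linear_combination b * r₃ - (a * r₁ - c * r₂) +
    α * (b * r₁ - a * r₃ - α * c * r₂)⟩
  c₀ := ⟨0, by linear_combination c * r₁ - b * r₂⟩
  c₁ := ⟨1, by linear_combination b * r₁ - a * r₃ - α * c * r₂⟩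
  c₂ := ⟨0, by linear_combination c * r₃ - a * r₂ + α * (c * r₁ - b * r₂)⟩
  aσ := by linear_combination b * c * r₂ - a * (b * r₁ - a * r₃ - α * c * r₂)
  bσ := by linear_combination a * (a * r₁ - c * r₂)
  cσ := by linear_combination a ^ 2 * r₂

theorem isQuadricBasis_secant (r₁ : a ^ 2 = 0) (r₂ : b ^ 2 = 0) (r₃ : c ^ 2 + 2 * a * b = 0) :
    IsQuadricBasis a b c (a * b) (a * c) (b * c) (a * b * c) where
  aa := ⟨0, 0, 0, by linear_combination r₁⟩
  ab := ⟨1, 0, 0, by ring⟩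
  ac := ⟨0, 1, 0, by ring⟩
  bb := ⟨0, 0, 0, by linear_combination r₂⟩
  bc := ⟨0, 0, 1, by ring⟩
  cc := ⟨-2, 0, 0, by linear_combination r₃⟩
  a₀ := ⟨0, by linear_combination b * r₁⟩
  a₁ := ⟨0, by linear_combination c * r₁⟩
  a₂ := ⟨1, by ring⟩
  b₀ := ⟨0, by linear_combination a * r₂⟩
  b₁ := ⟨1, by ring⟩
  b₂ := ⟨0, by linear_combination c * r₂⟩
  c₀ := ⟨1, by ring⟩
  c₁ := ⟨0, by linear_combination a * r₃ - 2 * b * r₁⟩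
  c₂ := ⟨0, by linear_combination b * r₃ - 2 * a * r₂⟩
  aσ := by linear_combination b * c * r₁
  bσ := by linear_combination a * c * r₂
  cσ := by linear_combination a * b * r₃ - 2 * b ^ 2 * r₁

theorem isQuadricBasis_triangle (r₁ : a ^ 2 = 0) (r₂ : b ^ 2 = 0) (r₃ : c ^ 2 = 0) :
    IsQuadricBasis a b c (a * b) (a * c) (b * c) (a * b * c) where
  aa := ⟨0, 0, 0, by linear_combination r₁⟩
  ab := ⟨1, 0, 0, by ring⟩
  ac := ⟨0, 1, 0, by ring⟩
  bb := ⟨0, 0, 0, by linear_combination r₂⟩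
  bc := ⟨0, 0, 1, by ring⟩
  cc := ⟨0, 0, 0, by linear_combination r₃⟩
  a₀ := ⟨0, by linear_combination b * r₁⟩
  a₁ := ⟨0, by linear_combination c * r₁⟩
  a₂ := ⟨1, by ring⟩
  b₀ := ⟨0, by linear_combination a * r₂⟩
  b₁ := ⟨1, by ring⟩
  b₂ := ⟨0, by linear_combination c * r₂⟩
  c₀ := ⟨1, by ring⟩
  c₁ := ⟨0, by linear_combination a * r₃⟩
  c₂ := ⟨0, by linear_combination b * r₃⟩
  aσ := by linear_combination b * c * r₁
  bσ := by linear_combination a * c * r₂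
  cσ := by linear_combination a * b * r₃

theorem isQuadricBasis_fermat (r₁ : b ^ 3 - a ^ 3 = 0) (r₂ : c ^ 3 - a ^ 3 = 0) (r₃ : a * b = 0)
    (r₄ : a * c = 0) (r₅ : b * c = 0) :
    IsQuadricBasis a b c (a * a) (b * b) (c * c) (a ^ 3) where
  aa := ⟨1, 0, 0, by ring⟩
  ab := ⟨0, 0, 0, by linear_combination r₃⟩
  ac := ⟨0, 0, 0, by linear_combination r₄⟩
  bb := ⟨0, 1, 0, by ring⟩
  bc := ⟨0, 0, 0, by linear_combination r₅⟩
  cc := ⟨0, 0, 1, by ring⟩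
  a₀ := ⟨1, by ring⟩
  a₁ := ⟨0, by linear_combination b * r₃⟩
  a₂ := ⟨0, by linear_combination c * r₄⟩
  b₀ := ⟨0, by linear_combination a * r₃⟩
  b₁ := ⟨1, by linear_combination r₁⟩
  b₂ := ⟨0, by linear_combination c * r₅⟩
  c₀ := ⟨0, by linear_combination a * r₄⟩
  c₁ := ⟨0, by linear_combination b * r₅⟩
  c₂ := ⟨1, by linear_combination r₂⟩
  aσ := by linear_combination b ^ 2 * r₃ - a * r₁
  bσ := by linear_combination a ^ 2 * r₃
  cσ := by linear_combination a ^ 2 * r₄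

/-- The socle relations come from `a c ^ 3 = a b ^ 3 = 0` and `c ^ 4 = c (a c ^ 2) = a c ^ 3`. -/
theorem isQuadricBasis_cusp (r₁ : a ^ 2 = 0) (r₂ : a * b = 0) (r₃ : b * c = 0)
    (r₄ : b ^ 3 - c ^ 3 = 0) (r₅ : a * c ^ 2 - c ^ 3 = 0) :
    IsQuadricBasis a b c (b * b) (c * c) (a * c) (c ^ 3) where
  aa := ⟨0, 0, 0, by linear_combination r₁⟩
  ab := ⟨0, 0, 0, by linear_combination r₂⟩
  ac := ⟨0, 0, 1, by ring⟩
  bb := ⟨1, 0, 0, by ring⟩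
  bc := ⟨0, 0, 0, by linear_combination r₃⟩
  cc := ⟨0, 1, 0, by ring⟩
  a₀ := ⟨0, by linear_combination b * r₂⟩
  a₁ := ⟨1, by linear_combination r₅⟩
  a₂ := ⟨0, by linear_combination c * r₁⟩
  b₀ := ⟨1, by linear_combination r₄⟩
  b₁ := ⟨0, by linear_combination c * r₃⟩
  b₂ := ⟨0, by linear_combination c * r₂⟩
  c₀ := ⟨0, by linear_combination b * r₃⟩
  c₁ := ⟨1, by ring⟩
  c₂ := ⟨1, by linear_combination r₅⟩
  aσ := by linear_combination b ^ 2 * r₂ - a * r₄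
  bσ := by linear_combination c ^ 2 * r₃
  cσ := by linear_combination b ^ 2 * r₂ - a * r₄ - c * r₅

theorem isQuadricBasis_tangent (r₁ : a ^ 2 = 0) (r₂ : a * b = 0) (r₃ : 2 * a * c + b ^ 2 = 0)
    (r₄ : c ^ 3 = 0) (r₅ : b * c ^ 2 = 0) :
    IsQuadricBasis a b c (a * c) (b * c) (c * c) (a * c ^ 2) where
  aa := ⟨0, 0, 0, by linear_combination r₁⟩
  ab := ⟨0, 0, 0, by linear_combination r₂⟩
  ac := ⟨1, 0, 0, by ring⟩
  bb := ⟨-2, 0, 0, by linear_combination r₃⟩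
  bc := ⟨0, 1, 0, by ring⟩
  cc := ⟨0, 0, 1, by ring⟩
  a₀ := ⟨0, by linear_combination c * r₁⟩
  a₁ := ⟨0, by linear_combination c * r₂⟩
  a₂ := ⟨1, by ring⟩
  b₀ := ⟨0, by linear_combination c * r₂⟩
  b₁ := ⟨-2, by linear_combination c * r₃⟩
  b₂ := ⟨0, by linear_combination r₅⟩
  c₀ := ⟨1, by ring⟩
  c₁ := ⟨0, by linear_combination r₅⟩
  c₂ := ⟨0, by linear_combination r₄⟩
  aσ := by linear_combination c ^ 2 * r₁
  bσ := by linear_combination c ^ 2 * r₂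
  cσ := by linear_combination a * r₄

/-- A quadric basis for `X 1, X 2, X 3` is one for `X 1, …, X n`, if the further elements have the
products prescribed in the normal forms. -/
theorem IsQuadricBasis.forall_mem {n : ℕ} {X : ℕ → B} {w₀ w₁ w₂ σ : B}
    (h : IsQuadricBasis (X 1) (X 2) (X 3) w₀ w₁ w₂ σ)
    (hmix : ∀ i j, 1 ≤ i → i < j → j ≤ n → 4 ≤ j → X i * X j = 0)
    (hsq : ∀ j, 4 ≤ j → j ≤ n → X j ^ 2 = σ)
    (hw₀ : w₀ ∈ Ideal.span {X 1, X 2, X 3}) (hw₁ : w₁ ∈ Ideal.span {X 1, X 2, X 3})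
    (hw₂ : w₂ ∈ Ideal.span {X 1, X 2, X 3}) (hσ : σ ∈ Ideal.span {w₀, w₁, w₂}) :
    (∀ i ∈ Set.Icc 1 n, ∀ j ∈ Set.Icc 1 n, X i * X j ∈ Ideal.span {w₀, w₁, w₂}) ∧
      (∀ i ∈ Set.Icc 1 n, ∀ w ∈ ({w₀, w₁, w₂} : Set B), X i * w ∈ Ideal.span {σ}) ∧
      ∀ i ∈ Set.Icc 1 n, X i * σ = 0 := by
  have hspan {y : B} (hy : ∃ r₀ r₁ r₂, y = r₀ * w₀ + r₁ * w₁ + r₂ * w₂) :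
      y ∈ Ideal.span {w₀, w₁, w₂} := by
    obtain ⟨r₀, r₁, r₂, rfl⟩ := hy
    refine add_mem (add_mem ?_ ?_) ?_ <;> refine Ideal.mul_mem_left _ _ (Ideal.subset_span ?_) <;>
      simp
  have hspan' {y : B} (hy : ∃ r, y = r * σ) : y ∈ Ideal.span {σ} := by
    obtain ⟨r, rfl⟩ := hy
    exact Ideal.mul_mem_left _ _ (Ideal.mem_span_singleton_self _)
  -- The further elements kill `X 1`, `X 2`, `X 3`, hence the quadrics and `σ`, so they impose no
  -- new conditions.
  have hkill (j : ℕ) (hj : 4 ≤ j) (hjn : j ≤ n) {y : B} (hy : y ∈ Ideal.span {X 1, X 2, X 3}) :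
      X j * y = 0 := by
    refine Submodule.span_induction (p := fun y _ ↦ X j * y = 0) ?_ (mul_zero _)
      (fun y z _ _ hy hz ↦ by rw [mul_add, hy, hz, add_zero])
      (fun r y _ hy ↦ by rw [smul_eq_mul, mul_left_comm, hy, mul_zero]) hy
    rintro y (rfl | rfl | rfl) <;> rw [mul_comm] <;> exact hmix _ _ (by omega) (by omega) hjn hj
  have hσ' : σ ∈ Ideal.span {X 1, X 2, X 3} := by
    refine Ideal.span_le.mpr ?_ hσ
    rintro y (rfl | rfl | rfl) <;> assumption
  have hcases (i : ℕ) (hi : i ∈ Set.Icc 1 n) : i = 1 ∨ i = 2 ∨ i = 3 ∨ (4 ≤ i ∧ i ≤ n) := by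
    obtain ⟨hi₁, hi₂⟩ := hi
    omega
  have hprod (i j : ℕ) (hi : i ∈ Set.Icc 1 n) (hj : j ∈ Set.Icc 1 n) (hij : i ≤ j) :
      X i * X j ∈ Ideal.span {w₀, w₁, w₂} := by
    rcases hcases j hj with rfl | rfl | rfl | ⟨hj₁, hj₂⟩
    · obtain rfl : i = 1 := le_antisymm hij hi.1
      exact hspan h.aa
    · obtain rfl | rfl : i = 1 ∨ i = 2 := by have := hi.1; omega
      · exact hspan h.ab
      · exact hspan h.bb
    · obtain rfl | rfl | rfl : i = 1 ∨ i = 2 ∨ i = 3 := by have := hi.1; omega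
      · exact hspan h.ac
      · exact hspan h.bc
      · exact hspan h.cc
    · rcases hij.eq_or_lt with rfl | hlt
      · rw [← pow_two, hsq i hj₁ hj₂]
        exact hσ
      · rw [hmix i j hi.1 hlt hj₂ hj₁]
        exact zero_mem _
  refine ⟨fun i hi j hj ↦ ?_, fun i hi w hw ↦ ?_, fun i hi ↦ ?_⟩
  · rcases le_total i j with hij | hij
    · exact hprod i j hi hj hij
    · rw [mul_comm]
      exact hprod j i hj hi hij
  · rcases hcases i hi with rfl | rfl | rfl | ⟨hi₁, hi₂⟩
    · obtain rfl | rfl | rfl := hw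
      exacts [hspan' h.a₀, hspan' h.a₁, hspan' h.a₂]
    · obtain rfl | rfl | rfl := hw
      exacts [hspan' h.b₀, hspan' h.b₁, hspan' h.b₂]
    · obtain rfl | rfl | rfl := hw
      exacts [hspan' h.c₀, hspan' h.c₁, hspan' h.c₂]
    · rw [hkill i hi₁ hi₂ (by obtain rfl | rfl | rfl := hw <;> assumption)]
      exact zero_mem _
  · rcases hcases i hi with rfl | rfl | rfl | ⟨hi₁, hi₂⟩
    exacts [h.aσ, h.bσ, h.cσ, hkill i hi₁ hi₂ hσ']

end QuadricBasis

/-! ### Comparison of `S ⧸ J` with `S ⧸ I` for `J ≤ I`. -/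

section Quotient

open IsLocalRing

variable {S : Type u} [CommRing S] [IsLocalRing S] {I : Ideal S} [IsLocalRing (S ⧸ I)]

theorem map_mk_maximalIdeal :
    (maximalIdeal S).map (Ideal.Quotient.mk I) = maximalIdeal (S ⧸ I) :=
  map_maximalIdeal_of_surjective _ Ideal.Quotient.mk_surjective

theorem mk_mem_maximalIdeal_iff {a : S} :
    Ideal.Quotient.mk I a ∈ maximalIdeal (S ⧸ I) ↔ a ∈ maximalIdeal S := by
  have := IsLocalHom.of_surjective (Ideal.Quotient.mk I) Ideal.Quotient.mk_surjective
  rw [← Ideal.mem_comap, maximalIdeal_comap]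

theorem exists_mem_maximalIdeal_pow {t : ℕ} {a : S ⧸ I} (ha : a ∈ maximalIdeal (S ⧸ I) ^ t) :
    ∃ b ∈ maximalIdeal S ^ t, Ideal.Quotient.mk I b = a := by
  rw [← map_mk_maximalIdeal, ← Ideal.map_pow] at ha
  exact (Ideal.mem_map_iff_of_surjective _ Ideal.Quotient.mk_surjective).mp ha

/-- The quotient by an ideal `J` of relations of the normal forms is not larger than `S ⧸ I`. -/
theorem le_of_isQuadricBasis [IsNoetherianRing S] {J : Ideal S} {n : ℕ} {x : ℕ → S}
    (hx : Ideal.span (x '' Set.Icc 1 n) = maximalIdeal S) (hn : 3 ≤ n)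
    (hI : I ≤ maximalIdeal S ^ 2)
    (hH : localHilbertFunction (S ⧸ I) 2 = 3) (hJI : J ≤ I) {w₀ w₁ w₂ σ : S} (hσI : σ ∉ I)
    (h : IsQuadricBasis (Ideal.Quotient.mk J (x 1)) (Ideal.Quotient.mk J (x 2))
      (Ideal.Quotient.mk J (x 3)) (Ideal.Quotient.mk J w₀) (Ideal.Quotient.mk J w₁)
      (Ideal.Quotient.mk J w₂) (Ideal.Quotient.mk J σ))
    (hmix : ∀ i j, 1 ≤ i → i < j → j ≤ n → 4 ≤ j → x i * x j ∈ J)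
    (hsq : ∀ j, 4 ≤ j → j ≤ n → x j ^ 2 - σ ∈ J)
    (hw₀ : w₀ ∈ Ideal.span {x 1, x 2, x 3} ^ 2) (hw₁ : w₁ ∈ Ideal.span {x 1, x 2, x 3} ^ 2)
    (hw₂ : w₂ ∈ Ideal.span {x 1, x 2, x 3} ^ 2)
    (hσ : Ideal.Quotient.mk J σ ∈ Ideal.span {Ideal.Quotient.mk J w₀, Ideal.Quotient.mk J w₁,
      Ideal.Quotient.mk J w₂}) : I ≤ J := by
  have hwX {w : S} (hw : w ∈ Ideal.span {x 1, x 2, x 3} ^ 2) : Ideal.Quotient.mk J w ∈ Ideal.span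
      {Ideal.Quotient.mk J (x 1), Ideal.Quotient.mk J (x 2), Ideal.Quotient.mk J (x 3)} := by
    have := Ideal.mem_map_of_mem (Ideal.Quotient.mk J) (Ideal.pow_le_self two_ne_zero hw)
    rwa [Ideal.map_span, Set.image_insert_eq, Set.image_insert_eq, Set.image_singleton] at this
  obtain ⟨h₁, h₂, h₃⟩ := h.forall_mem (n := n) (X := fun i ↦ Ideal.Quotient.mk J (x i))
    (fun i j hi hij hj hj4 ↦ by
      rw [← map_mul, Ideal.Quotient.eq_zero_iff_mem]; exact hmix i j hi hij hj hj4)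
    (fun j hj hj4 ↦ by rw [← map_pow, Ideal.Quotient.eq]; exact hsq j hj hj4)
    (hwX hw₀) (hwX hw₁) (hwX hw₂) hσ
  let w : Fin 3 → S := ![w₀, w₁, w₂]
  have hrange : ({Ideal.Quotient.mk J w₀, Ideal.Quotient.mk J w₁, Ideal.Quotient.mk J w₂} :
      Set (S ⧸ J)) = Set.range fun i ↦ Ideal.Quotient.mk J (w i) := by
    ext y
    simp [w, Fin.exists_fin_succ, eq_comm]
  rw [hrange] at h₁ h₂
  have hxm (i : ℕ) (hi : i ∈ Set.Icc 1 n) : x i ∈ maximalIdeal S :=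
    hx ▸ Ideal.subset_span ⟨i, hi, rfl⟩
  have hspan3 : Ideal.span {x 1, x 2, x 3} ≤ maximalIdeal S := by
    rw [Ideal.span_le]
    rintro y (rfl | rfl | rfl) <;> exact hxm _ ⟨by omega, by omega⟩
  have hw (i : Fin 3) : w i ∈ maximalIdeal S ^ 2 := by
    fin_cases i <;> refine Ideal.pow_right_mono hspan3 2 ?_ <;> assumption
  have hquad : ∀ f ∈ maximalIdeal S ^ 2, ∃ c : Fin 3 → S, f - ∑ i, c i * w i ∈ J := by
    intro f hf
    have hle : maximalIdeal S ^ 2 ≤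
        (Ideal.span (Set.range fun i ↦ Ideal.Quotient.mk J (w i))).comap (Ideal.Quotient.mk J) := by
      rw [← hx, pow_two, Ideal.span_mul_span', Ideal.span_le]
      rintro _ ⟨_, ⟨i, hi, rfl⟩, _, ⟨j, hj, rfl⟩, rfl⟩
      simp only [SetLike.mem_coe, Ideal.mem_comap, map_mul]
      exact h₁ i hi j hj
    obtain ⟨c, hc⟩ := Ideal.mem_span_range_iff_exists_fun.mp (hle hf)
    choose d hd using fun i ↦ Ideal.Quotient.mk_surjective (c i)
    refine ⟨d, ?_⟩
    rw [← Ideal.Quotient.eq, ← hc, map_sum]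
    exact Finset.sum_congr rfl fun i _ ↦ by rw [map_mul, hd]
  -- The three quadrics span a layer of dimension exactly 3 in `S ⧸ I`, so they are independent
  -- there.
  have hind : IndepLayer 2 fun i ↦ Ideal.Quotient.mk I (w i) := by
    refine indepLayer_of_spansLayer _ (fun i ↦ ?_) (fun a ha ↦ ?_) hH
    · rw [← map_mk_maximalIdeal, ← Ideal.map_pow]
      exact Ideal.mem_map_of_mem _ (hw i)
    · obtain ⟨f, hf, rfl⟩ := exists_mem_maximalIdeal_pow ha
      obtain ⟨c, hc⟩ := hquad f hf
      refine ⟨fun i ↦ Ideal.Quotient.mk I (c i), ?_⟩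
      have h0 := Ideal.Quotient.eq_zero_iff_mem.mpr (hJI hc)
      rw [map_sub, map_sum] at h0
      simp only [map_mul] at h0
      rw [h0]
      exact zero_mem _
  have hcub : ∀ a ∈ maximalIdeal S, ∀ i, Ideal.Quotient.mk J (a * w i) ∈
      Ideal.span {Ideal.Quotient.mk J σ} := by
    intro a ha i
    rw [← hx] at ha
    refine Submodule.span_induction (p := fun a _ ↦ Ideal.Quotient.mk J (a * w i) ∈
      Ideal.span {Ideal.Quotient.mk J σ}) ?_ (by simp) (fun a b _ _ ha hb ↦ ?_)
      (fun r a _ ha ↦ ?_) ha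
    · rintro _ ⟨j, hj, rfl⟩
      rw [map_mul]
      exact h₂ j hj _ ⟨i, rfl⟩
    · rw [add_mul, map_add]
      exact add_mem ha hb
    · rw [smul_eq_mul, mul_assoc, map_mul]
      exact Ideal.mul_mem_left _ _ ha
  have hsoc : ∀ a ∈ maximalIdeal S, a * σ ∈ J := by
    intro a ha
    rw [← hx] at ha
    refine Submodule.span_induction (p := fun a _ ↦ a * σ ∈ J) ?_ (by simp)
      (fun a b _ _ ha hb ↦ by rw [add_mul]; exact add_mem ha hb)
      (fun r a _ ha ↦ by rw [smul_eq_mul, mul_assoc]; exact Ideal.mul_mem_left _ _ ha) ha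
    rintro _ ⟨j, hj, rfl⟩
    rw [← Ideal.Quotient.eq_zero_iff_mem, map_mul]
    exact h₃ j hj
  -- Modulo `J`, `f ∈ I` is a combination of the quadrics. Independence puts its coefficients into
  -- the maximal ideal, so `f` is congruent to some `d * σ`. As `σ ∉ I`, also `d` is in the maximal
  -- ideal, which kills `σ` modulo `J`.
  intro f hf
  obtain ⟨c, hc⟩ := hquad f (hI hf)
  have hcm : ∀ i, c i ∈ maximalIdeal S := by
    have h0 : ∑ i, Ideal.Quotient.mk I (c i) * Ideal.Quotient.mk I (w i) = 0 := by
      simp only [← map_mul]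
      rw [← map_sum, Ideal.Quotient.eq_zero_iff_mem]
      simpa using sub_mem hf (hJI hc)
    intro i
    rw [← mk_mem_maximalIdeal_iff (I := I)]
    exact hind (fun i ↦ Ideal.Quotient.mk I (c i)) (by rw [h0]; exact zero_mem _) i
  have hfσ : Ideal.Quotient.mk J f ∈ Ideal.span {Ideal.Quotient.mk J σ} := by
    rw [Ideal.Quotient.eq.mpr hc, map_sum]
    exact Ideal.sum_mem _ fun i _ ↦ hcub _ (hcm i) i
  obtain ⟨d, hd⟩ := Ideal.mem_span_singleton'.mp hfσ
  obtain ⟨d, rfl⟩ := Ideal.Quotient.mk_surjective d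
  rw [← map_mul, Ideal.Quotient.eq] at hd
  have hdσ : d * σ ∈ I := by simpa using add_mem (hJI hd) hf
  have hdm : d ∈ maximalIdeal S := by
    rw [mem_maximalIdeal, mem_nonunits_iff]
    exact fun hu ↦ hσI ((Ideal.unit_mul_mem_iff_mem I hu).mp hdσ)
  simpa using sub_mem (hsoc d hdm) hd

end Quotient

/-! ### Identification of `I` with one of the six ideals. -/

section NormalForms

open IsLocalRing GorensteinNormalForm

variable {S : Type u} [CommRing S] [IsLocalRing S] [IsNoetherianRing S] {I : Ideal S}
  [IsLocalRing (S ⧸ I)]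

theorem span_union_le {R : Type*} [CommRing R] {I : Ideal R} {G₁ G₂ G₃ : Set R}
    (h₁ : ∀ g ∈ G₁, Ideal.Quotient.mk I g = 0) (h₂ : ∀ g ∈ G₂, Ideal.Quotient.mk I g = 0)
    (h₃ : ∀ g ∈ G₃, Ideal.Quotient.mk I g = 0) : Ideal.span (G₁ ∪ G₂ ∪ G₃) ≤ I := by
  rw [Ideal.span_le]
  rintro g ((hg | hg) | hg)
  exacts [Ideal.Quotient.eq_zero_iff_mem.mp (h₁ g hg), Ideal.Quotient.eq_zero_iff_mem.mp (h₂ g hg),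
    Ideal.Quotient.eq_zero_iff_mem.mp (h₃ g hg)]

theorem mul_mem_span_triple_pow_two {R : Type*} [CommRing R] {a b c y z : R}
    (hy : y ∈ ({a, b, c} : Set R)) (hz : z ∈ ({a, b, c} : Set R)) :
    y * z ∈ Ideal.span {a, b, c} ^ 2 := by
  rw [pow_two]
  exact Ideal.mul_mem_mul (Ideal.subset_span hy) (Ideal.subset_span hz)

theorem mem_span_triple_of_eq_mul {R : Type*} [CommRing R] {w₀ w₁ w₂ y r w : R} (hy : y = r * w)
    (hw : w ∈ ({w₀, w₁, w₂} : Set R)) : y ∈ Ideal.span {w₀, w₁, w₂} := by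
  rw [hy]
  exact Ideal.mul_mem_left _ _ (Ideal.subset_span hw)

/-- An ideal whose quotient satisfies the relations of a normal form is the corresponding ideal. -/
theorem eq_of_satisfiesNormalForm {n : ℕ} {x : ℕ → S}
    (hx : Ideal.span (x '' Set.Icc 1 n) = maximalIdeal S) (hn : 3 ≤ n)
    (hI : I ≤ maximalIdeal S ^ 2) (hH : localHilbertFunction (S ⧸ I) 2 = 3)
    {z : Fin 3 → S ⧸ I} {s : S ⧸ I} (hs : s ≠ 0) (hz : SatisfiesNormalForm z s)
    (hz₀ : Ideal.Quotient.mk I (x 1) = z 0) (hz₁ : Ideal.Quotient.mk I (x 2) = z 1)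
    (hz₂ : Ideal.Quotient.mk I (x 3) = z 2)
    (hmix : ∀ i j, 1 ≤ i → i < j → j ≤ n → 4 ≤ j →
      Ideal.Quotient.mk I (x i) * Ideal.Quotient.mk I (x j) = 0)
    (hsq : ∀ j, 4 ≤ j → j ≤ n → Ideal.Quotient.mk I (x j) ^ 2 = s) :
    (∃ α : S, I = I₁ n x α) ∨ I = I₂ n x ∨ I = I₃ n x ∨ I = I₄ n x ∨ I = I₅ n x ∨ I = I₆ n x := by
  have hmix' : ∀ g ∈ mixedProducts n x, Ideal.Quotient.mk I g = 0 := by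
    rintro _ ⟨i, j, hi, hij, hj, hj4, rfl⟩
    rw [map_mul]
    exact hmix i j hi hij hj hj4
  have hsq' {σ : S} (hσ : s = Ideal.Quotient.mk I σ) :
      ∀ g ∈ squaresMinus n x σ, Ideal.Quotient.mk I g = 0 := by
    rintro _ ⟨j, hj4, hj, rfl⟩
    rw [map_sub, map_pow, hsq j hj4 hj, hσ, sub_self]
  have hσI {σ : S} (hσ : s = Ideal.Quotient.mk I σ) : σ ∉ I := by
    rwa [← Ideal.Quotient.eq_zero_iff_mem, ← hσ]
  rcases hz with ⟨α, r₁, r₂, r₃, hs'⟩ | ⟨r₁, r₂, r₃, hs'⟩ | ⟨r₁, r₂, r₃, hs'⟩ |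
    ⟨r₁, r₂, r₃, r₄, r₅, hs'⟩ | ⟨r₁, r₂, r₃, r₄, r₅, hs'⟩ | ⟨r₁, r₂, r₃, r₄, r₅, hs'⟩
  · obtain ⟨α, rfl⟩ := Ideal.Quotient.mk_surjective α
    refine Or.inl ⟨α, ?_⟩
    have hσ : s = Ideal.Quotient.mk I (x 1 ^ 3) := by rw [hs', map_pow, hz₀]
    have hle : I₁ n x α ≤ I := by
      refine span_union_le ?_ hmix' (hsq' hσ)
      rintro g (rfl | rfl | rfl) <;>
        simp only [map_add, map_sub, map_mul, map_pow, hz₀, hz₁, hz₂] <;>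
        assumption
    have hJ {g : S} (hg : g ∈ ({x 1 * x 2 + x 3 ^ 2, x 1 * x 3, x 1 ^ 2 + x 2 ^ 2 - α * x 3 ^ 2} :
        Set S)) : Ideal.Quotient.mk (I₁ n x α) g = 0 :=
      Ideal.Quotient.eq_zero_iff_mem.mpr (Ideal.subset_span (Or.inl (Or.inl hg)))
    have q₁ := hJ (g := x 1 * x 2 + x 3 ^ 2) (by simp)
    have q₂ := hJ (g := x 1 * x 3) (by simp)
    have q₃ := hJ (g := x 1 ^ 2 + x 2 ^ 2 - α * x 3 ^ 2) (by simp)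
    simp only [map_add, map_sub, map_mul, map_pow] at q₁ q₂ q₃
    refine le_antisymm (le_of_isQuadricBasis hx hn hI hH hle (hσI hσ)
      (w₀ := x 3 * x 3) (w₁ := x 2 * x 3) (w₂ := x 2 * x 2) ?_
      (fun i j hi hij hj hj4 ↦ Ideal.subset_span (Or.inl (Or.inr ⟨i, j, hi, hij, hj, hj4, rfl⟩)))
      (fun j hj4 hj ↦ Ideal.subset_span (Or.inr ⟨j, hj4, hj, rfl⟩))
      (mul_mem_span_triple_pow_two (by simp) (by simp))
      (mul_mem_span_triple_pow_two (by simp) (by simp))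
      (mul_mem_span_triple_pow_two (by simp) (by simp)) ?_) hle
    · simpa only [map_mul, map_pow] using isQuadricBasis_nodal_or_smooth q₁ q₂ q₃
    -- Here `x 1 ^ 3` is congruent to `x 2 * (x 3 * x 3)` only by virtue of the relations. In the
    -- other five cases `σ` is visibly a multiple of one of the quadrics.
    · refine mem_span_triple_of_eq_mul (r := Ideal.Quotient.mk _ (x 2)) ?_ (Or.inl rfl)
      simp only [map_mul, map_pow]
      linear_combination -(Ideal.Quotient.mk (I₁ n x α) (x 2) * q₁ -
        Ideal.Quotient.mk (I₁ n x α) (x 1) * q₃ - Ideal.Quotient.mk (I₁ n x α) α *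
          Ideal.Quotient.mk (I₁ n x α) (x 3) * q₂)
  · refine Or.inr <| Or.inl ?_
    have hσ : s = Ideal.Quotient.mk I (x 1 * x 2 * x 3) := by
      rw [hs', map_mul, map_mul, hz₀, hz₁, hz₂]
    have hle : I₂ n x ≤ I := by
      refine span_union_le ?_ hmix' (hsq' hσ)
      rintro g (rfl | rfl | rfl) <;>
        simp only [map_add, map_mul, map_pow, map_ofNat, hz₀, hz₁, hz₂] <;> assumption
    have hJ {g : S} (hg : g ∈ ({x 1 ^ 2, x 2 ^ 2, x 3 ^ 2 + 2 * x 1 * x 2} : Set S)) :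
        Ideal.Quotient.mk (I₂ n x) g = 0 :=
      Ideal.Quotient.eq_zero_iff_mem.mpr (Ideal.subset_span (Or.inl (Or.inl hg)))
    have q₁ := hJ (g := x 1 ^ 2) (by simp)
    have q₂ := hJ (g := x 2 ^ 2) (by simp)
    have q₃ := hJ (g := x 3 ^ 2 + 2 * x 1 * x 2) (by simp)
    simp only [map_add, map_mul, map_pow, map_ofNat] at q₁ q₂ q₃
    refine le_antisymm (le_of_isQuadricBasis hx hn hI hH hle (hσI hσ)
      (w₀ := x 1 * x 2) (w₁ := x 1 * x 3) (w₂ := x 2 * x 3) ?_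
      (fun i j hi hij hj hj4 ↦ Ideal.subset_span (Or.inl (Or.inr ⟨i, j, hi, hij, hj, hj4, rfl⟩)))
      (fun j hj4 hj ↦ Ideal.subset_span (Or.inr ⟨j, hj4, hj, rfl⟩))
      (mul_mem_span_triple_pow_two (by simp) (by simp))
      (mul_mem_span_triple_pow_two (by simp) (by simp))
      (mul_mem_span_triple_pow_two (by simp) (by simp)) ?_) hle
    · simpa only [map_mul, map_pow] using isQuadricBasis_secant q₁ q₂ q₃
    · refine mem_span_triple_of_eq_mul (r := Ideal.Quotient.mk _ (x 3)) ?_ (Or.inl rfl)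
      simp only [map_mul]
      ring
  · refine Or.inr <| Or.inr <| Or.inl ?_
    have hσ : s = Ideal.Quotient.mk I (x 1 * x 2 * x 3) := by
      rw [hs', map_mul, map_mul, hz₀, hz₁, hz₂]
    have hle : I₃ n x ≤ I := by
      refine span_union_le ?_ hmix' (hsq' hσ)
      rintro g (rfl | rfl | rfl) <;> simp only [map_pow, hz₀, hz₁, hz₂] <;> assumption
    have hJ {g : S} (hg : g ∈ ({x 1 ^ 2, x 2 ^ 2, x 3 ^ 2} : Set S)) :
        Ideal.Quotient.mk (I₃ n x) g = 0 :=
      Ideal.Quotient.eq_zero_iff_mem.mpr (Ideal.subset_span (Or.inl (Or.inl hg)))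
    have q₁ := hJ (g := x 1 ^ 2) (by simp)
    have q₂ := hJ (g := x 2 ^ 2) (by simp)
    have q₃ := hJ (g := x 3 ^ 2) (by simp)
    simp only [map_pow] at q₁ q₂ q₃
    refine le_antisymm (le_of_isQuadricBasis hx hn hI hH hle (hσI hσ)
      (w₀ := x 1 * x 2) (w₁ := x 1 * x 3) (w₂ := x 2 * x 3) ?_
      (fun i j hi hij hj hj4 ↦ Ideal.subset_span (Or.inl (Or.inr ⟨i, j, hi, hij, hj, hj4, rfl⟩)))
      (fun j hj4 hj ↦ Ideal.subset_span (Or.inr ⟨j, hj4, hj, rfl⟩))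
      (mul_mem_span_triple_pow_two (by simp) (by simp))
      (mul_mem_span_triple_pow_two (by simp) (by simp))
      (mul_mem_span_triple_pow_two (by simp) (by simp)) ?_) hle
    · simpa only [map_mul, map_pow] using isQuadricBasis_triangle q₁ q₂ q₃
    · refine mem_span_triple_of_eq_mul (r := Ideal.Quotient.mk _ (x 3)) ?_ (Or.inl rfl)
      simp only [map_mul]
      ring
  · refine Or.inr <| Or.inr <| Or.inr <| Or.inl ?_
    have hσ : s = Ideal.Quotient.mk I (x 1 ^ 3) := by rw [hs', map_pow, hz₀]
    have hle : I₄ n x ≤ I := by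
      refine span_union_le ?_ ?_ (hsq' hσ)
      · rintro g (rfl | rfl) <;> simp only [map_sub, map_pow, hz₀, hz₁, hz₂] <;> assumption
      · rintro _ ⟨i, j, hi, hij, hj, rfl⟩
        rw [map_mul]
        rcases le_or_gt 4 j with hj4 | hj4
        · exact hmix i j hi hij hj hj4
        · obtain ⟨rfl, rfl⟩ | ⟨rfl, rfl⟩ | ⟨rfl, rfl⟩ : (i = 1 ∧ j = 2) ∨ (i = 1 ∧ j = 3) ∨
            (i = 2 ∧ j = 3) := by omega
          · rw [hz₀, hz₁, r₃]
          · rw [hz₀, hz₂, r₄]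
          · rw [hz₁, hz₂, r₅]
    have hJ {g : S} (hg : g ∈ ({x 2 ^ 3 - x 1 ^ 3, x 3 ^ 3 - x 1 ^ 3} : Set S)) :
        Ideal.Quotient.mk (I₄ n x) g = 0 :=
      Ideal.Quotient.eq_zero_iff_mem.mpr (Ideal.subset_span (Or.inl (Or.inl hg)))
    have hJ' {i j : ℕ} (hi : 1 ≤ i) (hij : i < j) (hj : j ≤ n) :
        Ideal.Quotient.mk (I₄ n x) (x i * x j) = 0 :=
      Ideal.Quotient.eq_zero_iff_mem.mpr
        (Ideal.subset_span (Or.inl (Or.inr ⟨i, j, hi, hij, hj, rfl⟩)))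
    have q₁ := hJ (g := x 2 ^ 3 - x 1 ^ 3) (by simp)
    have q₂ := hJ (g := x 3 ^ 3 - x 1 ^ 3) (by simp)
    have q₃ := hJ' (i := 1) (j := 2) (by omega) (by omega) (by omega)
    have q₄ := hJ' (i := 1) (j := 3) (by omega) (by omega) (by omega)
    have q₅ := hJ' (i := 2) (j := 3) (by omega) (by omega) (by omega)
    simp only [map_sub, map_mul, map_pow] at q₁ q₂ q₃ q₄ q₅
    refine le_antisymm (le_of_isQuadricBasis hx hn hI hH hle (hσI hσ)
      (w₀ := x 1 * x 1) (w₁ := x 2 * x 2) (w₂ := x 3 * x 3) ?_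
      (fun i j hi hij hj _ ↦ Ideal.subset_span (Or.inl (Or.inr ⟨i, j, hi, hij, hj, rfl⟩)))
      (fun j hj4 hj ↦ Ideal.subset_span (Or.inr ⟨j, hj4, hj, rfl⟩))
      (mul_mem_span_triple_pow_two (by simp) (by simp))
      (mul_mem_span_triple_pow_two (by simp) (by simp))
      (mul_mem_span_triple_pow_two (by simp) (by simp)) ?_) hle
    · simpa only [map_mul, map_pow] using isQuadricBasis_fermat q₁ q₂ q₃ q₄ q₅
    · refine mem_span_triple_of_eq_mul (r := Ideal.Quotient.mk _ (x 1)) ?_ (Or.inl rfl)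
      simp only [map_mul, map_pow]
      ring
  · refine Or.inr <| Or.inr <| Or.inr <| Or.inr <| Or.inl ?_
    have hσ : s = Ideal.Quotient.mk I (x 3 ^ 3) := by rw [hs', map_pow, hz₂]
    have hle : I₅ n x ≤ I := by
      refine span_union_le ?_ hmix' (hsq' hσ)
      rintro g (rfl | rfl | rfl | rfl | rfl) <;>
        simp only [map_sub, map_mul, map_pow, hz₀, hz₁, hz₂] <;> assumption
    have hJ {g : S} (hg : g ∈ ({x 1 ^ 2, x 1 * x 2, x 2 * x 3, x 2 ^ 3 - x 3 ^ 3,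
        x 1 * x 3 ^ 2 - x 3 ^ 3} : Set S)) : Ideal.Quotient.mk (I₅ n x) g = 0 :=
      Ideal.Quotient.eq_zero_iff_mem.mpr (Ideal.subset_span (Or.inl (Or.inl hg)))
    have q₁ := hJ (g := x 1 ^ 2) (by simp)
    have q₂ := hJ (g := x 1 * x 2) (by simp)
    have q₃ := hJ (g := x 2 * x 3) (by simp)
    have q₄ := hJ (g := x 2 ^ 3 - x 3 ^ 3) (by simp)
    have q₅ := hJ (g := x 1 * x 3 ^ 2 - x 3 ^ 3) (by simp)
    simp only [map_sub, map_mul, map_pow] at q₁ q₂ q₃ q₄ q₅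
    refine le_antisymm (le_of_isQuadricBasis hx hn hI hH hle (hσI hσ)
      (w₀ := x 2 * x 2) (w₁ := x 3 * x 3) (w₂ := x 1 * x 3) ?_
      (fun i j hi hij hj hj4 ↦ Ideal.subset_span (Or.inl (Or.inr ⟨i, j, hi, hij, hj, hj4, rfl⟩)))
      (fun j hj4 hj ↦ Ideal.subset_span (Or.inr ⟨j, hj4, hj, rfl⟩))
      (mul_mem_span_triple_pow_two (by simp) (by simp))
      (mul_mem_span_triple_pow_two (by simp) (by simp))
      (mul_mem_span_triple_pow_two (by simp) (by simp)) ?_) hle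
    · simpa only [map_mul, map_pow] using isQuadricBasis_cusp q₁ q₂ q₃ q₄ q₅
    · refine mem_span_triple_of_eq_mul (r := Ideal.Quotient.mk _ (x 3)) ?_ (Or.inr (Or.inl rfl))
      simp only [map_mul, map_pow]
      ring
  · refine Or.inr <| Or.inr <| Or.inr <| Or.inr <| Or.inr ?_
    have hσ : s = Ideal.Quotient.mk I (x 1 * x 3 ^ 2) := by rw [hs', map_mul, map_pow, hz₀, hz₂]
    have hle : I₆ n x ≤ I := by
      refine span_union_le ?_ hmix' (hsq' hσ)
      rintro g (rfl | rfl | rfl | rfl | rfl) <;>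
        simp only [map_add, map_mul, map_pow, map_ofNat, hz₀, hz₁, hz₂] <;> assumption
    have hJ {g : S} (hg : g ∈ ({x 1 ^ 2, x 1 * x 2, 2 * x 1 * x 3 + x 2 ^ 2, x 3 ^ 3,
        x 2 * x 3 ^ 2} : Set S)) : Ideal.Quotient.mk (I₆ n x) g = 0 :=
      Ideal.Quotient.eq_zero_iff_mem.mpr (Ideal.subset_span (Or.inl (Or.inl hg)))
    have q₁ := hJ (g := x 1 ^ 2) (by simp)
    have q₂ := hJ (g := x 1 * x 2) (by simp)
    have q₃ := hJ (g := 2 * x 1 * x 3 + x 2 ^ 2) (by simp)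
    have q₄ := hJ (g := x 3 ^ 3) (by simp)
    have q₅ := hJ (g := x 2 * x 3 ^ 2) (by simp)
    simp only [map_add, map_mul, map_pow, map_ofNat] at q₁ q₂ q₃ q₄ q₅
    refine le_antisymm (le_of_isQuadricBasis hx hn hI hH hle (hσI hσ)
      (w₀ := x 1 * x 3) (w₁ := x 2 * x 3) (w₂ := x 3 * x 3) ?_
      (fun i j hi hij hj hj4 ↦ Ideal.subset_span (Or.inl (Or.inr ⟨i, j, hi, hij, hj, hj4, rfl⟩)))
      (fun j hj4 hj ↦ Ideal.subset_span (Or.inr ⟨j, hj4, hj, rfl⟩))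
      (mul_mem_span_triple_pow_two (by simp) (by simp))
      (mul_mem_span_triple_pow_two (by simp) (by simp))
      (mul_mem_span_triple_pow_two (by simp) (by simp)) ?_) hle
    · simpa only [map_mul, map_pow] using isQuadricBasis_tangent q₁ q₂ q₃ q₄ q₅
    · refine mem_span_triple_of_eq_mul (r := Ideal.Quotient.mk _ (x 3)) ?_ (Or.inl rfl)
      simp only [map_mul, map_pow]
      ring

end NormalForms

/-! ### Lifting generators from `S ⧸ I` to `S`, and their minimality. -/

section MinimalGenerators

open IsLocalRing

/-- Generators of the maximal ideal are minimal, if each of them is separated from the others by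
multiplication with an element of `S ⧸ I`. -/
theorem isMinimalGenerators_of_separated {S : Type u} [CommRing S] [IsLocalRing S]
    {I : Ideal S} {n : ℕ} {x : ℕ → S}
    (hx : Ideal.span (x '' Set.Icc 1 n) = maximalIdeal S)
    (hsep : ∀ i ∈ Set.Icc 1 n, ∃ d : S ⧸ I, Ideal.Quotient.mk I (x i) * d ≠ 0 ∧
      ∀ j ∈ Set.Icc 1 n, j ≠ i → Ideal.Quotient.mk I (x j) * d = 0) :
    IsMinimalGenerators n x (maximalIdeal S) := by
  refine ⟨hx, fun T hT hspan ↦ ?_⟩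
  obtain ⟨i, hi, hiT⟩ := Set.exists_of_ssubset hT
  obtain ⟨d, hd, hd'⟩ := hsep i hi
  have hxi : x i ∈ Ideal.span (x '' T) := by
    rw [hspan, ← hx]
    exact Ideal.subset_span ⟨i, hi, rfl⟩
  refine hd (Submodule.span_induction (p := fun a _ ↦ Ideal.Quotient.mk I a * d = 0) ?_ (by simp)
    (fun a b _ _ ha hb ↦ by rw [map_add, add_mul, ha, hb, add_zero])
    (fun r a _ ha ↦ by rw [smul_eq_mul, map_mul, mul_assoc, ha, mul_zero]) hxi)
  rintro _ ⟨j, hj, rfl⟩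
  exact hd' j (hT.1 hj) fun h ↦ hiT (h ▸ hj)

variable {S : Type u} [CommRing S] [IsLocalRing S] [IsNoetherianRing S] {I : Ideal S}
  [IsLocalRing (S ⧸ I)]

/-- Elements generating the maximal ideal of `S ⧸ I` modulo its square lift to generators of the
maximal ideal of `S`, if `I` is contained in the square of the latter. -/
theorem span_image_eq_maximalIdeal (hI : I ≤ maximalIdeal S ^ 2) {T : Set ℕ} {x : ℕ → S}
    (hx : ∀ i ∈ T, Ideal.Quotient.mk I (x i) ∈ maximalIdeal (S ⧸ I))
    (hspan : ∀ b ∈ maximalIdeal (S ⧸ I), ∃ a ∈ Ideal.span (x '' T),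
      b - Ideal.Quotient.mk I a ∈ maximalIdeal (S ⧸ I) ^ 2) :
    Ideal.span (x '' T) = maximalIdeal S := by
  refine le_antisymm ?_ ?_
  · rw [Ideal.span_le]
    rintro _ ⟨i, hi, rfl⟩
    exact mk_mem_maximalIdeal_iff.mp (hx i hi)
  · refine Submodule.le_of_le_smul_of_le_jacobson_bot (IsNoetherian.noetherian _)
      (maximalIdeal_le_jacobson _) fun b hb ↦ ?_
    obtain ⟨a, ha, hba⟩ := hspan _ (mk_mem_maximalIdeal_iff.mpr hb)
    rw [← map_sub] at hba
    obtain ⟨c, hc, hcb⟩ := exists_mem_maximalIdeal_pow hba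
    -- The inclusion `I ≤ m ^ 2` turns the congruence in `S ⧸ I` into one modulo `m ^ 2` in `S`, so
    -- that Nakayama's lemma applies.
    have h1 : b - a ∈ maximalIdeal S ^ 2 := by
      rw [eq_comm, Ideal.Quotient.eq] at hcb
      simpa using add_mem (hI hcb) hc
    rw [smul_eq_mul, ← pow_two, ← add_sub_cancel a b]
    exact Submodule.add_mem_sup ha h1

end MinimalGenerators

/-! ### The socle of a Gorenstein ring with the given Hilbert function. -/

section Gorenstein

open IsLocalRing

variable {A : Type u} [CommRing A] [IsLocalRing A]

/-- The socle of a Gorenstein local ring of socle degree three. -/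
theorem exists_isSocleGenerator (hG : IsGorensteinLocalRing A)
    (h3 : localHilbertFunction A 3 = 1) (h4 : localHilbertFunction A 4 = 0) :
    ∃ s : A, IsSocleGenerator A s := by
  have := hG.isNoetherianRing
  have hM4 := maximalIdeal_pow_eq_bot_of_localHilbertFunction_eq_zero h4
  have hb := exists_basis_layer (A := A) 3
  rw [h3] at hb
  obtain ⟨w, hw, -, hind⟩ := hb
  -- If `w 0` were 0, independence would put the coefficient 1 into the maximal ideal.
  have hs0 : w 0 ≠ 0 := fun h0 ↦ by
    have := hind (fun _ ↦ 1) (by simp [h0]) 0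
    exact (Ideal.ne_top_iff_one _).mp (maximalIdeal.isMaximal A).ne_top this
  have hkill : ∀ a ∈ maximalIdeal A, a * w 0 = 0 := fun a ha ↦ by
    have : a * w 0 ∈ maximalIdeal A ^ 4 := by
      rw [pow_succ']
      exact Ideal.mul_mem_mul ha (hw 0)
    rwa [hM4, Ideal.mem_bot] at this
  obtain ⟨d, hd⟩ := hG.finite_injectiveDimension
  have := injective_of_hasInjectiveDimensionLE hM4 hs0 hkill d hd
  exact ⟨w 0, hM4, hw 0, hs0, fun t ht ↦ exists_eq_mul_of_injective hs0 ht⟩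

theorem three_ne_zero_of_ringChar_ne {k : Type*} [Field k] (h : ringChar k ≠ 3) : (3 : k) ≠ 0 := by
  intro h0
  rcases (Nat.dvd_prime Nat.prime_three).mp (ringChar.dvd (R := k) (by exact_mod_cast h0))
    with h1 | h1
  · exact CharP.ringChar_ne_one h1
  · exact h h1

end Gorenstein

/-! ### Assembly of the proof. -/

theorem theorem3p5 {S : Type u} [CommRing S] [IsRegularLocalRing S] (I : Ideal S)
    [IsLocalRing (S ⧸ I)] [IsArtinianRing (S ⧸ I)]
    (hI : I ≤ IsLocalRing.maximalIdeal S ^ 2)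
    (hGor : IsGorensteinLocalRing (S ⧸ I))
    [IsAlgClosed (IsLocalRing.ResidueField (S ⧸ I))]
    (hchar2 : ringChar (IsLocalRing.ResidueField (S ⧸ I)) ≠ 2)
    (hchar3 : ringChar (IsLocalRing.ResidueField (S ⧸ I)) ≠ 3)
    (n : ℕ) (hH : ∀ t : ℕ, localHilbertFunction (S ⧸ I) t = [1, n, 3, 1].getD t 0) :
    3 ≤ n ∧ ∃ x : ℕ → S, IsMinimalGenerators n x (IsLocalRing.maximalIdeal S) ∧
      ((∃ α : S, I = GorensteinNormalForm.I₁ n x α) ∨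
        I = GorensteinNormalForm.I₂ n x ∨
        I = GorensteinNormalForm.I₃ n x ∨
        I = GorensteinNormalForm.I₄ n x ∨
        I = GorensteinNormalForm.I₅ n x ∨
        I = GorensteinNormalForm.I₆ n x) := by
  have h2 : (2 : IsLocalRing.ResidueField (S ⧸ I)) ≠ 0 := Ring.two_ne_zero hchar2
  have h3 := three_ne_zero_of_ringChar_ne hchar3
  have h2u : IsUnit (2 : S ⧸ I) := by
    rw [← IsLocalRing.notMem_maximalIdeal, ← IsLocalRing.residue_eq_zero_iff, map_ofNat]
    exact h2
  have hH2 : localHilbertFunction (S ⧸ I) 2 = 3 := hH 2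
  obtain ⟨s, hs⟩ := exists_isSocleGenerator hGor (hH 3) (hH 4)
  obtain ⟨z, u, hz⟩ := hs.exists_isDualSystem hH2
  obtain ⟨s, z, u, hs, hz, hn⟩ := hz.exists_isCubicNormalForm hs h2 h3 (hz.spansLayer hs hH2)
  obtain ⟨z, hz, hnf⟩ := hz.exists_satisfiesNormalForm hs h2u (hz.spansLayer hs hH2) hn
  obtain ⟨m, y, hy, hm, hspan⟩ := hz.exists_isOrthonormalFamily hs h2u (hz.spansLayer hs hH2)
  obtain rfl : n = 3 + m := (hH 1).symm.trans hm
  -- Indices `1, 2, 3` carry the `z` and `4, …, 3 + m` the `y`. The values at `0` and beyond `3 + m`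
  -- are never used.
  let X : ℕ → S ⧸ I := fun i ↦ if h : i - 1 < 3 then z ⟨i - 1, h⟩ else
    if h : i - 4 < m then y ⟨i - 4, h⟩ else 0
  have hX4 (j : Fin m) : X (j + 4) = y j := by simp [X]
  choose x hx using fun i ↦ Ideal.Quotient.mk_surjective (X i)
  have hx3 (i : Fin 3) : Ideal.Quotient.mk I (x (i + 1)) = z i := by
    rw [hx]
    simp [X]
  have hx4 (j : Fin m) : Ideal.Quotient.mk I (x (j + 4)) = y j := by rw [hx, hX4]
  have hcases (i : ℕ) (hi : i ∈ Set.Icc 1 (3 + m)) :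
      (∃ j : Fin 3, i = j + 1) ∨ ∃ j : Fin m, i = j + 4 := by
    obtain ⟨hi₁, hi₂⟩ := hi
    rcases lt_or_ge i 4 with h | h
    · exact Or.inl ⟨⟨i - 1, by omega⟩, by simp; omega⟩
    · exact Or.inr ⟨⟨i - 4, by omega⟩, by simp; omega⟩
  have hmem3 (i : Fin 3) : (i : ℕ) + 1 ∈ Set.Icc 1 (3 + m) := ⟨by omega, by omega⟩
  have hmem4 (j : Fin m) : (j : ℕ) + 4 ∈ Set.Icc 1 (3 + m) := ⟨by omega, by omega⟩
  have hgen : Ideal.span (x '' Set.Icc 1 (3 + m)) = IsLocalRing.maximalIdeal S := by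
    refine span_image_eq_maximalIdeal hI (fun i hi ↦ ?_) fun b hb ↦ ?_
    · rcases hcases i hi with ⟨j, rfl⟩ | ⟨j, rfl⟩
      · rw [hx3]; exact hz.mem_z j
      · rw [hx4]; exact hy.mem j
    · obtain ⟨β, μ, h⟩ := hspan b hb
      choose β' hβ using fun i ↦ Ideal.Quotient.mk_surjective (β i)
      choose μ' hμ using fun i ↦ Ideal.Quotient.mk_surjective (μ i)
      refine ⟨∑ i, β' i * x (i + 1) + ∑ j, μ' j * x (j + 4), add_mem
        (Ideal.sum_mem _ fun i _ ↦ Ideal.mul_mem_left _ _ (Ideal.subset_span ⟨_, hmem3 i, rfl⟩))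
        (Ideal.sum_mem _ fun j _ ↦ Ideal.mul_mem_left _ _ (Ideal.subset_span ⟨_, hmem4 j, rfl⟩)),
        ?_⟩
      simpa only [map_add, map_sum, map_mul, hβ, hμ, hx3, hx4] using h
  -- Minimality: the first three generators are separated from the others by the dual elements `u
  -- i`, and each later one by its own class `y i`.
  refine ⟨by omega, x, isMinimalGenerators_of_separated (I := I) hgen fun i hi ↦ ?_,
    eq_of_satisfiesNormalForm hgen (by omega) hI hH2 hs.ne_zero hnf (hx3 0) (hx3 1) (hx3 2)
      (fun i j hi hij hj hj4 ↦ ?_) fun j hj4 hj ↦ ?_⟩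
  · rcases hcases i hi with ⟨i, rfl⟩ | ⟨i, rfl⟩
    · refine ⟨u i, ?_, fun j hj hij ↦ ?_⟩
      · rw [hx3, hz.mul_eq, if_pos rfl]
        exact hs.ne_zero
      · rcases hcases j hj with ⟨j, rfl⟩ | ⟨j, rfl⟩
        · rw [hx3, hz.mul_eq, if_neg fun h ↦ hij (by rw [h])]
        · rw [hx4, hy.mul_pow_two j _ (hz.mem_u i)]
    · refine ⟨y i, ?_, fun j hj hij ↦ ?_⟩
      · rw [hx4, hy.mul_eq, if_pos rfl]
        exact hs.ne_zero
      · rcases hcases j hj with ⟨j, rfl⟩ | ⟨j, rfl⟩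
        · rw [hx3, hy.z_mul]
        · rw [hx4, hy.mul_eq, if_neg fun h ↦ hij (by rw [h])]
  · rcases hcases j ⟨by omega, hj⟩ with ⟨j, rfl⟩ | ⟨j, rfl⟩
    · omega
    · rcases hcases i ⟨hi, by omega⟩ with ⟨i, rfl⟩ | ⟨i, rfl⟩
      · rw [hx3, hx4, hy.z_mul]
      · rw [hx4, hx4, hy.mul_eq, if_neg fun h ↦ by subst h; omega]
  · rcases hcases j ⟨by omega, hj⟩ with ⟨j, rfl⟩ | ⟨j, rfl⟩
    · omega
    · rw [hx4, pow_two, hy.mul_eq, if_pos rfl]
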